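/- For an integer $m\ge 0$ let $$V_m(x)=\frac1{m!}\int_0^\infty \frac{u^m e^{-u}}{\sqrt{x^2+u}}\,du ,\qquad x\in\mathbb R,$$ be the Coulomb potential regularized by a Landau state. For $N\in\mathbb N$, nuclear charge $Z\ge 1$, magnetic field strength $B>0$, and locally integrable real potentials $\widetilde V_j$ ($1\le j\le N$) and $\widetilde W_{jk}$ ($1\le j<k\le N$) on $\mathbb R$, consider the one-dimensional $N$-electron Hamiltonian $$h(N,Z,B^{-1/2})=\sum_{j=1}^N\Big[-\sqrt B\,\frac{d^2}{dx_j^2}-Z\,\widetilde V_j(x_j)\Big]+\sum_{j<k}\widetilde W_{jk}(x_j-x_k)$$ with ground state energy $E_0(N)=\inf\langle\Phi,h\,\Phi\rangle$ over $\Phi\in C_c^\infty(\mathbb R^N;\mathbb C)$ with $\|\Phi\|_{L^2}=1$. Let $E_0^{(k)}(N-1)$ be the ground state energy, defined in the same way, of the $(N-1)$-electron Hamiltonian obtained by omitting all terms that involve $x_k$. The Hamiltonian has a bound state if $E_0(N)<E_0^{(k)}(N-1)$ for every $k$ (when the potentials do not depend on $j,k$ this is $E_0(N)<E_0(N-1)$).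 **Theorem.** There are a constant $a_1>0$ and constants $a_2=a_2(\gamma,C)>0$ (both independent of $\alpha$), and for every $\alpha>0$ a constant $A_\alpha>0$, such that the following holds. Let $\mu,\nu$ be integers with $1\le\nu\le 2\mu$, and suppose that for all $x\in\mathbb R$ $$\widetilde V_j(x)\le V_\mu(x)\quad(\text{all } j),\qquad \widetilde W_{jk}(x)\ge \tfrac1{\sqrt2}\,V_{\nu-1}\big(\tfrac{x}{\sqrt2}\big)\quad(\text{all } j<k).$$ Suppose that either $\nu\le C$ and $\gamma>2$ (the case $\nu=O(1)$), or $\nu\le CN$ and $\gamma>3$ (the case $\nu=O(N)$). If $$N>2Z+A_\alpha Z^{1+\alpha}\qquad\text{and}\qquad a_1e^{Z^{\alpha/4}}>B\ge a_2Z^{\gamma},$$ then $h(N,Z,B^{-1/2})$ has no bound state. -/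

import Mathlib

open scoped ContDiff

noncomputable section

namespace StrongField

/-- The regularized Coulomb potential of the Landau state with angular momentum `-m` (field
strength scaled to `1`), `V_m(x) = (1/m!) ∫₀^∞ u^m e^{-u} (x² + u)^{-1/2} du`. -/
def landauPotential (m : ℕ) (x : ℝ) : ℝ :=
  (1 / (m.factorial : ℝ)) *
    ∫ u in Set.Ioi (0 : ℝ), u ^ m * Real.exp (-u) / Real.sqrt (x ^ 2 + u)

/-- The one-dimensional Hamiltonian of particles labelled by `ι`, acting on `Φ(x)`,
`x = (x_j)_{j ∈ ι}`:
`∑_j [-(1/M) d²/dx_j² - Z V_j(x_j)] + ∑_{j<k} W_{jk}(x_j - x_k)`. -/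
def hamiltonian {ι : Type} [Fintype ι] [LinearOrder ι] (Z M : ℝ)
    (V : ι → ℝ → ℝ) (W : ι → ι → ℝ → ℝ) (Φ : (ι → ℝ) → ℂ) (x : ι → ℝ) : ℂ :=
  ∑ j, (-((1 / M : ℝ) : ℂ) * iteratedDeriv 2 (fun t : ℝ => Φ (Function.update x j t)) (x j)
      - ((Z * V j (x j) : ℝ) : ℂ) * Φ x)
    + ∑ j, ∑ k, if j < k then ((W j k (x j - x k) : ℝ) : ℂ) * Φ x else 0

/-- Normalized trial functions: `Φ ∈ C_c^∞(ℝ^ι; ℂ)` with `‖Φ‖_{L²} = 1`. -/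
def IsTrial {ι : Type} [Fintype ι] (Φ : (ι → ℝ) → ℂ) : Prop :=
  ContDiff ℝ ∞ Φ ∧ HasCompactSupport Φ ∧ ∫ x, ‖Φ x‖ ^ 2 = 1

/-- The ground state energy `inf_{‖Φ‖ = 1} ⟨Φ, h Φ⟩`. For locally integrable potentials whose
sum is bounded below, `C_c^∞` is a form core, so this is the bottom of the spectrum of `h`. -/
def groundEnergy {ι : Type} [Fintype ι] [LinearOrder ι] (Z M : ℝ)
    (V : ι → ℝ → ℝ) (W : ι → ι → ℝ → ℝ) : EReal :=
  ⨅ Φ : {Φ : (ι → ℝ) → ℂ // IsTrial Φ},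
    (((∫ x, (starRingEnd ℂ) (Φ.1 x) * hamiltonian Z M V W Φ.1 x).re : ℝ) : EReal)

/-- The ground state energy of the `(N-1)`-particle Hamiltonian obtained from the `N`-particle
one by omitting all terms that involve `x_k`. -/
def groundEnergyOmit {N : ℕ} (Z M : ℝ) (V : Fin N → ℝ → ℝ) (W : Fin N → Fin N → ℝ → ℝ)
    (k : Fin N) : EReal :=
  groundEnergy (ι := {j : Fin N // j ≠ k}) Z M (fun j => V j) (fun i j => W i j)

/-- The `N`-particle Hamiltonian has a bound state, in the sense `E₀(N) < E₀(N - 1)`: its ground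
state energy is below that of each system left after removing one particle. If the potentials do
not depend on the particle labels, the energies `groundEnergyOmit Z M V W k` all agree. -/
def HasBoundState {N : ℕ} (Z M : ℝ) (V : Fin N → ℝ → ℝ) (W : Fin N → Fin N → ℝ → ℝ) : Prop :=
  ∀ k : Fin N, groundEnergy Z M V W < groundEnergyOmit Z M V W k

end StrongField

end

noncomputable section

namespace StrongField

open MeasureTheory Set

/-! The method is localization with weights adapted to the removal of one particle. Put `ρ² = ∑_k
(x_k² + R²)` and `g_k = √(x_k² + R²) f / ρ`, so that `∑_k |g_k|² = |f|²`. Passing from `f` to the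
`g_k` costs at most `N√B |f|²/ρ²` (`sum_energyDensity_le`). In the energy of `g_k` particle `k` is
split off: the other particles contribute at least `E₀^{(k)}(N-1)`, by Fubini
(`integral_energyDensity_ge_without`), and what remains is `-√B ∂_k² - Z V_k` plus the repulsion
felt by particle `k`.

Two estimates decide the sign of this remainder. A Riccati subsolution (`exists_riccati`,
`integral_riccati_le_integral_kinetic`) shows that `-√B d²/dt² - Z V ≥ -Z' / √(t² + R²)`, where `Z'`
is `Z` times a squared logarithm. Tested against the weights `x_k² + R²`, this attraction costs `Z'
∑_k √(x_k² + R²)`, while the repulsion, symmetrized over pairs, gains `(N-1)/2 · ∑_k √(x_k² + R²)`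
(`sum_pairs_ge`). Since this sum is at least `N R`, the surplus also pays the localization error
once `Z' + √B/R ≤ (N-1)/2`; then the energy of `f` is not below the least `E₀^{(k)}(N-1)`.

The Landau potentials enter only through algebraic bounds of Jensen type. The scale is `R = max(√ν,
√B/Z)`, which makes `√B/R ≤ Z`; the exponential upper bound on `B` keeps the logarithm below a
multiple of `Z^{α/4}`. -/

/-! ### Algebraic bounds for the Landau potentials. -/

theorem integrableOn_pow_mul_exp_neg (m : ℕ) :
    IntegrableOn (fun u : ℝ => u ^ m * Real.exp (-u)) (Ioi 0) := by
  refine (Real.GammaIntegral_convergent (s := m + 1) (by positivity)).congr_fun ?_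
    measurableSet_Ioi
  intro u _
  simp [mul_comm]

theorem integral_pow_mul_exp_neg (m : ℕ) :
    ∫ u in Ioi (0 : ℝ), u ^ m * Real.exp (-u) = m.factorial := by
  rw [← Real.Gamma_nat_eq_factorial, Real.Gamma_eq_integral (by positivity)]
  refine setIntegral_congr_fun measurableSet_Ioi ?_
  intro u _
  simp [mul_comm]

/-- Since `√u ≤ √(x² + u)`, the Gamma integrand with parameter `m + 1/2` dominates, uniformly in
`x`. -/
theorem integrableOn_landau (m : ℕ) (x : ℝ) :
    IntegrableOn (fun u : ℝ => u ^ m * Real.exp (-u) / Real.sqrt (x ^ 2 + u)) (Ioi 0) := by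
  have h := Real.GammaIntegral_convergent (s := m + 1 / 2) (by positivity)
  refine Integrable.mono' h ?_ ?_
  · refine Measurable.aestronglyMeasurable ?_
    fun_prop
  · refine (ae_restrict_iff' measurableSet_Ioi).2 (Filter.Eventually.of_forall fun u hu => ?_)
    have hu : 0 < u := hu
    have hs : 0 < Real.sqrt u := Real.sqrt_pos.2 hu
    rw [Real.norm_of_nonneg (by positivity)]
    have e1 : u ^ ((m : ℝ) + 1 / 2 - 1) = u ^ m / Real.sqrt u := by
      rw [Real.sqrt_eq_rpow, ← Real.rpow_natCast, ← Real.rpow_sub hu]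
      congr 1; ring
    rw [e1]
    have : Real.sqrt u ≤ Real.sqrt (x ^ 2 + u) := Real.sqrt_le_sqrt (by nlinarith)
    calc u ^ m * Real.exp (-u) / Real.sqrt (x ^ 2 + u)
        ≤ u ^ m * Real.exp (-u) / Real.sqrt u := by gcongr
      _ = _ := by ring

theorem inv_tangent_le {r t : ℝ} (hr : 0 < r) (ht : 0 < t) :
    1 / r - (t ^ 2 - r ^ 2) / (2 * r ^ 3) ≤ 1 / t := by
  rw [← sub_nonneg]
  have : 1 / t - (1 / r - (t ^ 2 - r ^ 2) / (2 * r ^ 3))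
      = (t - r) ^ 2 * (t + 2 * r) / (2 * r ^ 3 * t) := by
    field_simp; ring
  rw [this]; positivity

/-- Jensen for the convex function `u ↦ (x² + u)^{-1/2}` and the Gamma density `u^m e^{-u}/m!`,
whose mean is `m + 1`. The tangent line at the mean is integrated explicitly. -/
theorem le_landauPotential (m : ℕ) (x : ℝ) :
    1 / Real.sqrt (x ^ 2 + (m + 1)) ≤ landauPotential m x := by
  set r := Real.sqrt (x ^ 2 + (m + 1)) with hr
  have hr0 : 0 < r := Real.sqrt_pos.2 (by positivity)
  have hr2 : r ^ 2 = x ^ 2 + (m + 1) := Real.sq_sqrt (by positivity)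
  set a := 1 / r + (m + 1) / (2 * r ^ 3) with ha
  set b := 1 / (2 * r ^ 3) with hb
  have i1 := (integrableOn_pow_mul_exp_neg m).const_mul a
  have i2 := (integrableOn_pow_mul_exp_neg (m + 1)).const_mul b
  have key : ∫ u in Ioi (0 : ℝ), (a * (u ^ m * Real.exp (-u)) - b * (u ^ (m + 1) * Real.exp (-u)))
      ≤ ∫ u in Ioi (0 : ℝ), u ^ m * Real.exp (-u) / Real.sqrt (x ^ 2 + u) := by
    refine setIntegral_mono_on (i1.sub i2) (integrableOn_landau m x) measurableSet_Ioi ?_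
    intro u hu
    have hu : 0 < u := hu
    have ht0 : 0 < Real.sqrt (x ^ 2 + u) := Real.sqrt_pos.2 (by positivity)
    have ht2 : Real.sqrt (x ^ 2 + u) ^ 2 = x ^ 2 + u := Real.sq_sqrt (by positivity)
    have h := inv_tangent_le hr0 ht0
    rw [ht2, hr2] at h
    have e : a * (u ^ m * Real.exp (-u)) - b * (u ^ (m + 1) * Real.exp (-u))
        = u ^ m * Real.exp (-u) * (1 / r - (x ^ 2 + u - (x ^ 2 + (m + 1))) / (2 * r ^ 3)) := by
      rw [ha, hb]; ring
    rw [e, div_eq_mul_one_div (u ^ m * Real.exp (-u))]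
    exact mul_le_mul_of_nonneg_left h (by positivity)
  rw [integral_sub i1 i2, integral_const_mul, integral_const_mul, integral_pow_mul_exp_neg,
    integral_pow_mul_exp_neg] at key
  have hm : (0 : ℝ) < m.factorial := by exact_mod_cast m.factorial_pos
  have e : a * (m.factorial : ℝ) - b * ((m + 1).factorial : ℝ) = m.factorial * (1 / r) := by
    rw [Nat.factorial_succ, ha, hb]; push_cast; ring
  rw [e] at key
  rw [landauPotential, one_div (m.factorial : ℝ), le_inv_mul_iff₀ hm]
  exact key

/-- By AM-GM, `1/t ≤ (l/t² + 1/l)/2`, so it suffices that the mean of `1/t² = 1/(x² + u)` is at most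
`1/l²`. Moving one factor `u` from the density into the function leaves the concave function `u/(x²
+ u)` against a density of mean `n + 1`, and its tangent there gives the bound. -/
theorem landauPotential_succ_le (n : ℕ) (x : ℝ) :
    landauPotential (n + 1) x ≤ 1 / Real.sqrt (x ^ 2 + (n + 1)) := by
  set l := Real.sqrt (x ^ 2 + (n + 1)) with hl
  have hl0 : 0 < l := Real.sqrt_pos.2 (by positivity)
  have hl2 : l ^ 2 = x ^ 2 + (n + 1) := Real.sq_sqrt (by positivity)
  set p := l / 2 * ((n + 1) / l ^ 2 - x ^ 2 * (n + 1) / l ^ 4) with hp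
  set q := l / 2 * (x ^ 2 / l ^ 4) + 1 / (2 * l) with hq
  have i1 := (integrableOn_pow_mul_exp_neg n).const_mul p
  have i2 := (integrableOn_pow_mul_exp_neg (n + 1)).const_mul q
  have key : ∫ u in Ioi (0 : ℝ), u ^ (n + 1) * Real.exp (-u) / Real.sqrt (x ^ 2 + u)
      ≤ ∫ u in Ioi (0 : ℝ), (p * (u ^ n * Real.exp (-u)) + q * (u ^ (n + 1) * Real.exp (-u))) := by
    refine setIntegral_mono_on (integrableOn_landau (n + 1) x) (i1.add i2) measurableSet_Ioi ?_
    intro u hu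
    have hu : 0 < u := hu
    set t := Real.sqrt (x ^ 2 + u) with ht
    have ht0 : 0 < t := Real.sqrt_pos.2 (by positivity)
    have ht2 : t ^ 2 = x ^ 2 + u := Real.sq_sqrt (by positivity)
    have h1 : 1 / t ≤ l / 2 * (1 / t ^ 2) + 1 / (2 * l) := by
      rw [← sub_nonneg]
      have : l / 2 * (1 / t ^ 2) + 1 / (2 * l) - 1 / t = (l - t) ^ 2 / (2 * l * t ^ 2) := by
        field_simp; ring
      rw [this]; positivity
    have h2 : u * (1 / t ^ 2) ≤ (n + 1) / l ^ 2 + x ^ 2 * (u - (n + 1)) / l ^ 4 := by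
      rw [← sub_nonneg]
      have h4 : l ^ 4 = (l ^ 2) ^ 2 := by ring
      have : (n + 1) / l ^ 2 + x ^ 2 * (u - (n + 1)) / l ^ 4 - u * (1 / t ^ 2)
          = x ^ 2 * (u - (n + 1)) ^ 2 / (t ^ 2 * l ^ 4) := by
        rw [h4, ht2, hl2]
        have : x ^ 2 + u ≠ 0 := by positivity
        have : x ^ 2 + ((n : ℝ) + 1) ≠ 0 := by positivity
        field_simp; ring
      rw [this]; positivity
    calc u ^ (n + 1) * Real.exp (-u) / t
        = u ^ (n + 1) * Real.exp (-u) * (1 / t) := by ring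
      _ ≤ u ^ (n + 1) * Real.exp (-u) * (l / 2 * (1 / t ^ 2) + 1 / (2 * l)) := by gcongr
      _ = u ^ n * Real.exp (-u) * (l / 2 * (u * (1 / t ^ 2)))
          + u ^ (n + 1) * Real.exp (-u) * (1 / (2 * l)) := by ring
      _ ≤ u ^ n * Real.exp (-u) * (l / 2 * ((n + 1) / l ^ 2 + x ^ 2 * (u - (n + 1)) / l ^ 4))
          + u ^ (n + 1) * Real.exp (-u) * (1 / (2 * l)) := by gcongr
      _ = _ := by rw [hp, hq]; ring
  rw [integral_add i1 i2, integral_const_mul, integral_const_mul, integral_pow_mul_exp_neg,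
    integral_pow_mul_exp_neg] at key
  have hm : (0 : ℝ) < (n + 1).factorial := by exact_mod_cast (n + 1).factorial_pos
  have e : p * (n.factorial : ℝ) + q * ((n + 1).factorial : ℝ) = (n + 1).factorial * (1 / l) := by
    rw [Nat.factorial_succ, hp, hq]; push_cast
    field_simp; ring
  rw [e] at key
  rw [landauPotential, one_div, inv_mul_le_iff₀ hm]
  exact key

/-! ### A one-dimensional Schrödinger lower bound. -/

/-- The growth in `x` is only logarithmic. Bounding it by a square root makes the square of the
right side at most linear in `√(x² + R²)/R`, which the decay in the Riccati estimate absorbs. -/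
theorem abs_arsinh_div_le {s R x : ℝ} (hs : 0 < s) (hsR : s ≤ R) :
    |Real.arsinh (x / s)| ≤ Real.log (2 * R / s) + 2 * Real.sqrt (Real.sqrt (x ^ 2 + R ^ 2) / R) := by
  have hR : 0 < R := hs.trans_le hsR
  set T := Real.sqrt (x ^ 2 + R ^ 2) with hT
  have hT0 : 0 < T := Real.sqrt_pos.2 (by positivity)
  have hT2 : T ^ 2 = x ^ 2 + R ^ 2 := Real.sq_sqrt (by positivity)
  have hxT : |x| ≤ T := abs_le_of_sq_le_sq (by nlinarith) hT0.le
  have e : |Real.arsinh (x / s)| = Real.arsinh (|x| / s) := by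
    rcases le_total 0 x with h | h
    · rw [abs_of_nonneg h, abs_of_nonneg (Real.arsinh_nonneg_iff.2 (by positivity))]
    · have h' : x / s ≤ 0 := div_nonpos_of_nonpos_of_nonneg h hs.le
      rw [abs_of_nonpos h, abs_of_nonpos (Real.arsinh_nonpos_iff.2 h'), neg_div, Real.arsinh_neg]
  rw [e, Real.arsinh]
  have h1 : Real.sqrt (1 + (|x| / s) ^ 2) ≤ T / s := by
    rw [Real.sqrt_le_left (by positivity)]
    rw [div_pow, div_pow, sq_abs, hT2]
    have : (x ^ 2 + R ^ 2) / s ^ 2 = x ^ 2 / s ^ 2 + R ^ 2 / s ^ 2 := by ring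
    have : 1 ≤ R ^ 2 / s ^ 2 := by
      rw [one_le_div (by positivity)]; gcongr
    linarith
  have h2 : |x| / s ≤ T / s := by gcongr
  have h3 : |x| / s + Real.sqrt (1 + (|x| / s) ^ 2) ≤ 2 * R / s * (T / R) := by
    calc _ ≤ T / s + T / s := by linarith
      _ = _ := by field_simp; ring
  have hpos : 0 < |x| / s + Real.sqrt (1 + (|x| / s) ^ 2) := by positivity
  have h4 : Real.log (T / R) ≤ 2 * Real.sqrt (T / R) := by
    have h := Real.log_le_sub_one_of_pos (Real.sqrt_pos.2 (by positivity : 0 < T / R))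
    rw [Real.log_sqrt (by positivity)] at h
    linarith
  calc _ ≤ Real.log (2 * R / s * (T / R)) := Real.log_le_log hpos h3
    _ = Real.log (2 * R / s) + Real.log (T / R) := Real.log_mul (by positivity) (by positivity)
    _ ≤ _ := by linarith

/-- A Riccati subsolution showing that `-R d²/dx² - (x² + s²)^{-1/2} + K (x² + R²)^{-1/2} ≥ 0`
with `K = O(1 + log²(R / s))`. -/
theorem exists_riccati {s R : ℝ} (hs : 0 < s) (hsR : s ≤ R) :
    ∃ φ φ' : ℝ → ℝ, (∀ x, HasDerivAt φ (φ' x) x) ∧ Continuous φ' ∧ ∀ x,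
      1 / Real.sqrt (x ^ 2 + s ^ 2)
        - (14 + 3 * Real.log (2 * R / s) ^ 2) / Real.sqrt (x ^ 2 + R ^ 2)
        ≤ R * (φ' x - φ x ^ 2) := by
  have hR : 0 < R := hs.trans_le hsR
  have hT0 : ∀ x : ℝ, 0 < Real.sqrt (x ^ 2 + R ^ 2) := fun x => Real.sqrt_pos.2 (by positivity)
  have hS0 : ∀ x : ℝ, 0 < Real.sqrt (x ^ 2 + s ^ 2) := fun x => Real.sqrt_pos.2 (by positivity)
  -- `arsinh (x/s)` is an antiderivative of `(x² + s²)^{-1/2}`. The factor `R/√(x² + R²)` in `R φ`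
  -- is close to `1` for `|x| ≪ R` and makes `φ` decay beyond that scale.
  refine ⟨fun x => Real.arsinh (x / s) / Real.sqrt (x ^ 2 + R ^ 2),
    fun x => 1 / (Real.sqrt (x ^ 2 + s ^ 2) * Real.sqrt (x ^ 2 + R ^ 2))
      - x * Real.arsinh (x / s) / Real.sqrt (x ^ 2 + R ^ 2) ^ 3, ?_, ?_, ?_⟩
  · intro x
    have h1 : HasDerivAt (fun x : ℝ => Real.arsinh (x / s)) (1 / Real.sqrt (x ^ 2 + s ^ 2)) x := by
      refine (((hasDerivAt_id' x).div_const s).arsinh).congr_deriv ?_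
      have : 1 + (x / s) ^ 2 = (x ^ 2 + s ^ 2) / s ^ 2 := by field_simp; ring
      rw [this, Real.sqrt_div' _ (sq_nonneg s), Real.sqrt_sq hs.le, smul_eq_mul]
      field_simp
    have h2 : HasDerivAt (fun x : ℝ => Real.sqrt (x ^ 2 + R ^ 2))
        (x / Real.sqrt (x ^ 2 + R ^ 2)) x := by
      have h : HasDerivAt (fun x : ℝ => x ^ 2 + R ^ 2) (2 * x) x := by
        simpa using (hasDerivAt_pow 2 x).add_const (R ^ 2)
      refine (h.sqrt (by positivity)).congr_deriv ?_
      field_simp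
    refine (h1.div h2 (hT0 x).ne').congr_deriv ?_
    have := hT0 x
    have := hS0 x
    field_simp
  · refine Continuous.sub (Continuous.div continuous_const (by fun_prop) fun x => ?_)
      (Continuous.div ?_ (by fun_prop) fun x => ?_)
    · exact (mul_pos (hS0 x) (hT0 x)).ne'
    · exact continuous_id.mul (Real.continuous_arsinh.comp (continuous_id.div_const s))
    · exact (pow_pos (hT0 x) 3).ne'
  · intro x
    have hT := hT0 x
    have hS := hS0 x
    have hlog : 0 ≤ Real.log (2 * R / s) :=
      Real.log_nonneg (by rw [le_div_iff₀ hs]; linarith)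
    have ha := abs_arsinh_div_le (x := x) hs hsR
    set L := Real.log (2 * R / s)
    set a := Real.arsinh (x / s)
    have hT2 : Real.sqrt (x ^ 2 + R ^ 2) ^ 2 = x ^ 2 + R ^ 2 := Real.sq_sqrt (by positivity)
    have hS2 : Real.sqrt (x ^ 2 + s ^ 2) ^ 2 = x ^ 2 + s ^ 2 := Real.sq_sqrt (by positivity)
    set T := Real.sqrt (x ^ 2 + R ^ 2)
    set S := Real.sqrt (x ^ 2 + s ^ 2)
    have hRT : R ≤ T := by nlinarith
    have hxT : |x| ≤ T := abs_le_of_sq_le_sq (by nlinarith) hT.le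
    have hTS : T - R ≤ S := by nlinarith
    have ha2 : a ^ 2 ≤ 2 * L ^ 2 + 8 * (T / R) := by
      have hq : Real.sqrt (T / R) ^ 2 = T / R := Real.sq_sqrt (by positivity)
      have h0 : 0 ≤ Real.sqrt (T / R) := Real.sqrt_nonneg _
      have : a ^ 2 ≤ (L + 2 * Real.sqrt (T / R)) ^ 2 := by
        rw [← sq_abs a]; gcongr
      nlinarith [sq_nonneg (L - 2 * Real.sqrt (T / R))]
    -- The price of the cutoff in the leading term of `R φ'`; it accounts for one unit of the
    -- constant `14`.
    have h1 : 1 / S - R / (S * T) ≤ 1 / T := by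
      have : 1 / S - R / (S * T) = (T - R) / S * (1 / T) := by field_simp
      rw [this]
      have : (T - R) / S ≤ 1 := (div_le_one hS).2 hTS
      calc _ ≤ 1 * (1 / T) := by gcongr
        _ = _ := by ring
    have hxa : x * a ≤ T * ((1 + a ^ 2) / 2) := by
      calc x * a ≤ |x| * |a| := by rw [← abs_mul]; exact le_abs_self _
        _ ≤ T * ((1 + a ^ 2) / 2) := by
          gcongr
          nlinarith [sq_nonneg (|a| - 1), sq_abs a]
    have h2 : R * (x * a / T ^ 3) ≤ R * ((1 + a ^ 2) / 2) / T ^ 2 := by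
      calc R * (x * a / T ^ 3) ≤ R * (T * ((1 + a ^ 2) / 2) / T ^ 3) := by gcongr
        _ = _ := by field_simp
    have h3 : R * ((1 + a ^ 2) / 2) / T ^ 2 + R * (a / T) ^ 2 ≤ (13 + 3 * L ^ 2) / T := by
      have : R * ((1 + a ^ 2) / 2) / T ^ 2 + R * (a / T) ^ 2
          = (R / T * (1 / 2 + 3 / 2 * a ^ 2)) / T := by field_simp; ring
      rw [this]
      gcongr
      have hRT1 : R / T ≤ 1 := (div_le_one hT).2 hRT
      have hRT0 : 0 ≤ R / T := by positivity
      calc R / T * (1 / 2 + 3 / 2 * a ^ 2)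
          ≤ R / T * (1 / 2 + 3 / 2 * (2 * L ^ 2 + 8 * (T / R))) := by gcongr
        _ = R / T * (1 / 2 + 3 * L ^ 2) + 12 := by field_simp; ring
        _ ≤ 1 * (1 / 2 + 3 * L ^ 2) + 12 := by gcongr
        _ ≤ _ := by linarith
    have h4 : (14 + 3 * L ^ 2) / T = 1 / T + (13 + 3 * L ^ 2) / T := by ring
    have h5 : R * (1 / (S * T) - x * a / T ^ 3 - (a / T) ^ 2)
        = R / (S * T) - R * (x * a / T ^ 3) - R * (a / T) ^ 2 := by ring
    simp only
    rw [h4, h5]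
    linarith

/-! ### Local integrability of the potentials on configuration space. -/

theorem locallyIntegrable_comp_eval {ι : Type} [Fintype ι] {v : ℝ → ℝ} (hv : LocallyIntegrable v)
    (j : ι) : LocallyIntegrable (fun x : ι → ℝ => v (x j)) := by
  rw [locallyIntegrable_iff]
  intro K hK
  obtain ⟨r, hr⟩ := hK.isBounded.subset_closedBall 0
  have hbox : K ⊆ Set.univ.pi fun _ : ι => Metric.closedBall (0 : ℝ) (max r 0) := by
    refine hr.trans fun x hx => ?_
    have hx' : ‖x‖ ≤ r := by simpa using hx
    intro i _
    simpa using Or.inl ((norm_le_pi_norm x i).trans hx')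
  refine IntegrableOn.mono_set ?_ hbox
  rw [IntegrableOn, volume_pi, Measure.restrict_pi_pi]
  have : IsFiniteMeasure (volume.restrict (Metric.closedBall (0 : ℝ) (max r 0))) :=
    ⟨by rw [Measure.restrict_apply_univ]; exact measure_closedBall_lt_top⟩
  refine integrable_comp_eval (f := v)
    (μ := fun _ : ι => volume.restrict (Metric.closedBall (0 : ℝ) (max r 0))) ?_
  exact (hv.integrableOn_isCompact (isCompact_closedBall _ _))

/-- The shear `x_j ↦ x_j - x_k`. -/
def shear {ι : Type} [DecidableEq ι] (j k : ι) (h : j ≠ k) : (ι → ℝ) ≃ₜ (ι → ℝ) where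
  toFun x := Function.update x j (x j - x k)
  invFun x := Function.update x j (x j + x k)
  left_inv x := by simp [h.symm]
  right_inv x := by simp [h.symm]
  continuous_toFun := by fun_prop
  continuous_invFun := by fun_prop

theorem measurePreserving_shear {ι : Type} [Fintype ι] [DecidableEq ι] (j k : ι) (h : j ≠ k) :
    MeasurePreserving (shear j k h) := by
  have := Real.volume_preserving_transvectionStruct (⟨j, k, h, -1⟩ : Matrix.TransvectionStruct ι ℝ)
  convert this using 1
  funext x i
  simp only [shear, Homeomorph.homeomorph_mk_coe, Equiv.coe_fn_mk,
    Matrix.TransvectionStruct.toMatrix_mk, Matrix.transvection, Matrix.single_mulVec,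
    Matrix.toLin'_apply, Matrix.add_mulVec, Matrix.one_mulVec, Pi.add_apply]
  rcases eq_or_ne i j with rfl | hij
  · simp [sub_eq_add_neg]
  · simp [hij]

theorem locallyIntegrable_comp_sub {ι : Type} [Fintype ι] [DecidableEq ι] {v : ℝ → ℝ}
    (hv : LocallyIntegrable v) {j k : ι} (h : j ≠ k) :
    LocallyIntegrable (fun x : ι → ℝ => v (x j - x k)) := by
  rw [locallyIntegrable_iff]
  intro K hK
  have h1 := (locallyIntegrable_comp_eval hv j).integrableOn_isCompact
    (hK.image (shear j k h).continuous)
  rw [(measurePreserving_shear j k h).integrableOn_image (shear j k h).measurableEmbedding] at h1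
  refine h1.congr (Filter.Eventually.of_forall fun x => ?_)
  simp [shear]

/-! ### Partial derivatives of smooth functions. -/

section Calculus

variable {ι : Type} [Fintype ι] [DecidableEq ι]

/-- The partial derivative `∂f/∂x_j`. -/
def pd (j : ι) (f : (ι → ℝ) → ℂ) (x : ι → ℝ) : ℂ := fderiv ℝ f x (Pi.single j 1)

theorem contDiff_pd {f : (ι → ℝ) → ℂ} (hf : ContDiff ℝ ∞ f) (j : ι) : ContDiff ℝ ∞ (pd j f) :=
  (hf.fderiv_right (m := ∞) (by simp)).clm_apply contDiff_const

theorem hasCompactSupport_pd {f : (ι → ℝ) → ℂ} (hf : HasCompactSupport f) (j : ι) :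
    HasCompactSupport (pd j f) :=
  hf.fderiv_apply (𝕜 := ℝ) (Pi.single j 1)

theorem hasDerivAt_comp_update {f : (ι → ℝ) → ℂ} (hf : ContDiff ℝ ∞ f) (x : ι → ℝ) (j : ι)
    (t : ℝ) :
    HasDerivAt (fun t : ℝ => f (Function.update x j t)) (pd j f (Function.update x j t)) t :=
  ((hf.differentiable (by simp) _).hasFDerivAt).comp_hasDerivAt t (hasDerivAt_update x j t)

theorem iteratedDeriv_two_comp_update {f : (ι → ℝ) → ℂ} (hf : ContDiff ℝ ∞ f) (x : ι → ℝ) (j : ι)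
    (t : ℝ) : iteratedDeriv 2 (fun t : ℝ => f (Function.update x j t)) t
      = pd j (pd j f) (Function.update x j t) := by
  rw [iteratedDeriv_succ, iteratedDeriv_one]
  have : deriv (fun t : ℝ => f (Function.update x j t))
      = fun t => pd j f (Function.update x j t) :=
    funext fun t => (hasDerivAt_comp_update hf x j t).deriv
  rw [this]
  exact (hasDerivAt_comp_update (contDiff_pd hf j) x j t).deriv

theorem hasLineDerivAt_pd {f : (ι → ℝ) → ℂ} (hf : ContDiff ℝ ∞ f) (x : ι → ℝ) (j : ι) :
    HasLineDerivAt ℝ f (pd j f x) x (Pi.single j 1) :=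
  ((hf.differentiable (by simp) _).hasFDerivAt).hasLineDerivAt _

end Calculus

/-! ### The energy form and the variational principle. -/

section Energy

variable {ι : Type} [Fintype ι] [LinearOrder ι]

/-- The kinetic energy density `-Re (conj f ∂_j² f)` of particle `j`. -/
def kinetic (j : ι) (f : (ι → ℝ) → ℂ) (x : ι → ℝ) : ℝ :=
  -((starRingEnd ℂ) (f x) * pd j (pd j f) x).re

/-- The potential energy `-Z ∑ V_j + ∑ W_{jk}`. -/
def potential (Z : ℝ) (V : ι → ℝ → ℝ) (W : ι → ι → ℝ → ℝ) (x : ι → ℝ) : ℝ :=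
  -Z * ∑ j, V j (x j) + ∑ j, ∑ k, if j < k then W j k (x j - x k) else 0

/-- The real part of `conj f · h f`. -/
def energyDensity (Z M : ℝ) (V : ι → ℝ → ℝ) (W : ι → ι → ℝ → ℝ) (f : (ι → ℝ) → ℂ)
    (x : ι → ℝ) : ℝ :=
  (1 / M) * ∑ j, kinetic j f x + potential Z V W x * ‖f x‖ ^ 2

theorem conj_mul_hamiltonian {Z M : ℝ} {V : ι → ℝ → ℝ} {W : ι → ι → ℝ → ℝ} {f : (ι → ℝ) → ℂ}
    (hf : ContDiff ℝ ∞ f) (x : ι → ℝ) :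
    (starRingEnd ℂ) (f x) * hamiltonian Z M V W f x
      = -((1 / M : ℝ) : ℂ) * ∑ j, (starRingEnd ℂ) (f x) * pd j (pd j f) x
        + ((potential Z V W x * ‖f x‖ ^ 2 : ℝ) : ℂ) := by
  have hn : (starRingEnd ℂ) (f x) * f x = ((‖f x‖ ^ 2 : ℝ) : ℂ) := by
    rw [mul_comm, Complex.mul_conj, Complex.normSq_eq_norm_sq]
  have h1 : hamiltonian Z M V W f x = -((1 / M : ℝ) : ℂ) * ∑ j, pd j (pd j f) x
      + ((potential Z V W x : ℝ) : ℂ) * f x := by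
    simp only [hamiltonian, potential, iteratedDeriv_two_comp_update hf, Function.update_eq_self]
    rw [Finset.sum_sub_distrib, ← Finset.mul_sum, ← Finset.sum_mul]
    have e : ∀ j k : ι, (if j < k then ((W j k (x j - x k) : ℝ) : ℂ) * f x else 0)
        = (((if j < k then W j k (x j - x k) else 0 : ℝ)) : ℂ) * f x := by
      intro j k; split_ifs <;> simp
    simp only [e, ← Finset.sum_mul]
    push_cast
    rw [← Finset.mul_sum]
    ring
  rw [h1, mul_add, ← Finset.mul_sum, Complex.ofReal_mul, ← hn]
  ring

theorem integrable_kinetic {f : (ι → ℝ) → ℂ} (hf : ContDiff ℝ ∞ f) (hc : HasCompactSupport f)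
    (j : ι) : Integrable (fun x => (starRingEnd ℂ) (f x) * pd j (pd j f) x) := by
  refine Continuous.integrable_of_hasCompactSupport ?_ ?_
  · exact (Complex.continuous_conj.comp hf.continuous).mul
      (contDiff_pd (contDiff_pd hf j) j).continuous
  · exact (hasCompactSupport_pd (hasCompactSupport_pd hc j) j).mul_left

theorem continuous_normSq {X : Type*} [TopologicalSpace X] {f : X → ℂ} (hf : Continuous f) :
    Continuous fun x => ‖f x‖ ^ 2 := by fun_prop

theorem hasCompactSupport_normSq {X : Type*} [TopologicalSpace X] {f : X → ℂ}
    (hc : HasCompactSupport f) : HasCompactSupport fun x => ‖f x‖ ^ 2 :=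
  hc.comp_left (g := fun z : ℂ => ‖z‖ ^ 2) (by simp)

theorem integrable_mul_normSq {v : (ι → ℝ) → ℝ} (hv : LocallyIntegrable v) {f : (ι → ℝ) → ℂ}
    (hf : Continuous f) (hc : HasCompactSupport f) : Integrable fun x => v x * ‖f x‖ ^ 2 :=
  hv.integrable_smul_right_of_hasCompactSupport (continuous_normSq hf) (hasCompactSupport_normSq hc)

theorem locallyIntegrable_potential {Z : ℝ} {V : ι → ℝ → ℝ} {W : ι → ι → ℝ → ℝ}
    (hV : ∀ j, LocallyIntegrable (V j)) (hW : ∀ j k, j < k → LocallyIntegrable (W j k)) :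
    LocallyIntegrable (potential Z V W) := by
  unfold potential
  refine LocallyIntegrable.add ?_ ?_
  · exact (locallyIntegrable_finsetSum _ fun j _ => locallyIntegrable_comp_eval (hV j) j).smul (-Z)
  · refine locallyIntegrable_finsetSum _ fun j _ => locallyIntegrable_finsetSum _ fun k _ => ?_
    by_cases h : j < k
    · simpa [h] using locallyIntegrable_comp_sub (hW j k h) h.ne
    · simp [h, locallyIntegrable_const]

theorem integrable_energyDensity {Z M : ℝ} {V : ι → ℝ → ℝ} {W : ι → ι → ℝ → ℝ}
    (hV : ∀ j, LocallyIntegrable (V j)) (hW : ∀ j k, j < k → LocallyIntegrable (W j k))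
    {f : (ι → ℝ) → ℂ} (hf : ContDiff ℝ ∞ f) (hc : HasCompactSupport f) :
    Integrable (energyDensity Z M V W f) := by
  refine Integrable.add ?_ (integrable_mul_normSq (locallyIntegrable_potential hV hW)
    hf.continuous hc)
  exact (integrable_finsetSum _ fun j _ => (integrable_kinetic hf hc j).re.neg).const_mul _

theorem re_integral_hamiltonian {Z M : ℝ} {V : ι → ℝ → ℝ} {W : ι → ι → ℝ → ℝ}
    (hV : ∀ j, LocallyIntegrable (V j)) (hW : ∀ j k, j < k → LocallyIntegrable (W j k))
    {f : (ι → ℝ) → ℂ} (hf : ContDiff ℝ ∞ f) (hc : HasCompactSupport f) :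
    (∫ x, (starRingEnd ℂ) (f x) * hamiltonian Z M V W f x).re
      = ∫ x, energyDensity Z M V W f x := by
  have hi : Integrable fun x => (starRingEnd ℂ) (f x) * hamiltonian Z M V W f x := by
    simp only [conj_mul_hamiltonian hf]
    exact ((integrable_finsetSum _ fun j _ => integrable_kinetic hf hc j).const_mul _).add
      (integrable_mul_normSq (locallyIntegrable_potential hV hW) hf.continuous hc).ofReal
  have h := integral_re hi
  simp only [RCLike.re_to_complex] at h
  rw [← h]
  refine integral_congr_ae (Filter.Eventually.of_forall fun x => ?_)
  simp only [conj_mul_hamiltonian hf, energyDensity, kinetic]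
  rw [Complex.add_re, Complex.ofReal_re, ← Complex.ofReal_neg, Complex.re_ofReal_mul,
    Complex.re_sum, Finset.sum_neg_distrib]
  ring

/-- The variational principle for functions that need not be normalized. -/
theorem mul_integral_le_integral_energyDensity {Z M e : ℝ} {V : ι → ℝ → ℝ} {W : ι → ι → ℝ → ℝ}
    (hV : ∀ j, LocallyIntegrable (V j)) (hW : ∀ j k, j < k → LocallyIntegrable (W j k))
    (he : (e : EReal) ≤ groundEnergy Z M V W)
    {f : (ι → ℝ) → ℂ} (hf : ContDiff ℝ ∞ f) (hc : HasCompactSupport f) :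
    e * ∫ x, ‖f x‖ ^ 2 ≤ ∫ x, energyDensity Z M V W f x := by
  set n := ∫ x, ‖f x‖ ^ 2 with hn
  have hn0 : 0 ≤ n := integral_nonneg fun x => by positivity
  rcases hn0.eq_or_lt with h0 | hpos
  · have hz : (fun x => ‖f x‖ ^ 2) = 0 := by
      have h1 := (integral_eq_zero_iff_of_nonneg (fun x => by positivity)
        ((continuous_normSq hf.continuous).integrable_of_hasCompactSupport
          (hasCompactSupport_normSq hc))).1 (hn.symm.trans h0.symm)
      exact (Continuous.ae_eq_iff_eq volume (continuous_normSq hf.continuous) continuous_const).1 h1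
    have hz' : f = 0 := by
      funext x
      simpa using congrFun hz x
    rw [← h0, hz']
    have : ∀ j : ι, pd j (0 : (ι → ℝ) → ℂ) = 0 := fun j => by
      funext x
      simp [pd]
    simp [energyDensity, kinetic, this]
  · set c : ℝ := 1 / Real.sqrt n with hcdef
    have hc2 : c ^ 2 * n = 1 := by
      rw [hcdef, div_pow, Real.sq_sqrt hn0]; field_simp
    set g : (ι → ℝ) → ℂ := fun x => (c : ℂ) * f x with hg
    have hgs : ContDiff ℝ ∞ g := contDiff_const.mul hf
    have hgc : HasCompactSupport g := hc.mul_left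
    have hng : ∀ x, ‖g x‖ ^ 2 = c ^ 2 * ‖f x‖ ^ 2 := fun x => by
      simp [hg, mul_pow]
    have htrial : IsTrial g := by
      refine ⟨hgs, hgc, ?_⟩
      simp only [hng]
      rw [integral_const_mul, ← hn, hc2]
    have h1 := he.trans (iInf_le _ (⟨g, htrial⟩ : {Φ : (ι → ℝ) → ℂ // IsTrial Φ}))
    rw [EReal.coe_le_coe_iff, re_integral_hamiltonian hV hW hgs hgc] at h1
    have hpd : ∀ (j : ι) (u : (ι → ℝ) → ℂ), ContDiff ℝ ∞ u →
        pd j (fun x => (c : ℂ) * u x) = fun x => (c : ℂ) * pd j u x := by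
      intro j u hu
      funext x
      simp only [pd]
      rw [fderiv_const_mul (hu.differentiable (by simp) x)]
      simp
    have h2 : ∀ x, energyDensity Z M V W g x = c ^ 2 * energyDensity Z M V W f x := by
      intro x
      have hk : ∀ j, kinetic j g x = c ^ 2 * kinetic j f x := by
        intro j
        simp only [kinetic, hg]
        rw [hpd j f hf, hpd j _ (contDiff_pd hf j), map_mul, Complex.conj_ofReal]
        have : (c : ℂ) * (starRingEnd ℂ) (f x) * ((c : ℂ) * pd j (pd j f) x)
            = ((c ^ 2 : ℝ) : ℂ) * ((starRingEnd ℂ) (f x) * pd j (pd j f) x) := by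
          push_cast; ring
        rw [this, Complex.re_ofReal_mul]
        ring
      simp only [energyDensity, hk, hng, ← Finset.mul_sum]
      ring
    simp only [h2] at h1
    rw [integral_const_mul] at h1
    calc e * n ≤ (c ^ 2 * ∫ x, energyDensity Z M V W f x) * n := by gcongr
      _ = (c ^ 2 * n) * ∫ x, energyDensity Z M V W f x := by ring
      _ = _ := by rw [hc2, one_mul]

end Energy

/-! ### Integration by parts and the Riccati bound on the kinetic energy. -/

section LineDeriv

variable {ι : Type} [Fintype ι] [DecidableEq ι]

theorem integral_eq_zero_of_hasLineDerivAt {F F' : (ι → ℝ) → ℝ} {v : ι → ℝ} (hF : Integrable F)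
    (hF' : Integrable F') (h : ∀ x, HasLineDerivAt ℝ F (F' x) x v) : ∫ x, F' x = 0 := by
  have := integral_bilinear_hasLineDerivAt_right_eq_neg_left_of_integrable
    (μ := (volume : Measure (ι → ℝ))) (f := fun _ => (1 : ℝ)) (f' := fun _ => (0 : ℝ)) (g := F)
    (g' := F') (v := v) (B := ContinuousLinearMap.mul ℝ ℝ) (by simp) (by simpa using hF')
    (by simpa using hF) (fun x _ => hasDerivAt_const _ _) (fun x _ => h x)
  simpa using this

end LineDeriv

section Kinetic

variable {ι : Type} [Fintype ι] [LinearOrder ι]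

/-- The one-dimensional inequality `-d²/dt² ≥ φ' - φ²`, applied to one of the particles. -/
theorem integral_riccati_le_integral_kinetic {φ φ' : ℝ → ℝ} (hφ : ∀ t, HasDerivAt φ (φ' t) t)
    (hφ' : Continuous φ') {f : (ι → ℝ) → ℂ} (hf : ContDiff ℝ ∞ f) (hc : HasCompactSupport f)
    (k : ι) : ∫ x, (φ' (x k) - φ (x k) ^ 2) * ‖f x‖ ^ 2 ≤ ∫ x, kinetic k f x := by
  have hφc : Continuous φ := continuous_iff_continuousAt.2 fun t => (hφ t).continuousAt
  have fc := hf.continuous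
  have pc := (contDiff_pd hf k).continuous
  have ppc := (contDiff_pd (contDiff_pd hf k) k).continuous
  set p := pd k f with hp
  set r := pd k p with hr
  have hn : ∀ z : ℂ, ‖z‖ ^ 2 = z.re ^ 2 + z.im ^ 2 := fun z => by
    rw [← Complex.normSq_eq_norm_sq, Complex.normSq_apply]; ring
  -- `F = -Re(conj f ∂_k f) - φ |f|²` is chosen so that the kinetic density minus `(φ' - φ²)|f|²`
  -- minus `∂_k F` equals `|∂_k f + φ f|² ≥ 0`; the integral of `∂_k F` vanishes.
  set F : (ι → ℝ) → ℝ := fun x =>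
    -((f x).re * (p x).re + (f x).im * (p x).im) - φ (x k) * ((f x).re ^ 2 + (f x).im ^ 2) with hF
  set F' : (ι → ℝ) → ℝ := fun x =>
    -((p x).re * (p x).re + (f x).re * (r x).re + ((p x).im * (p x).im + (f x).im * (r x).im))
      - (φ' (x k) * ((f x).re ^ 2 + (f x).im ^ 2)
        + φ (x k) * (2 * (f x).re * (p x).re + 2 * (f x).im * (p x).im)) with hF'
  have hz : ∀ x, x ∉ tsupport f → f x = 0 ∧ p x = 0 := fun x hx => by
    have h1 := image_eq_zero_of_notMem_tsupport hx
    refine ⟨h1, ?_⟩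
    have : x ∉ tsupport (fderiv ℝ f) := fun h => hx (tsupport_fderiv_subset ℝ h)
    rw [hp, pd, image_eq_zero_of_notMem_tsupport this]
    simp
  have iF : Integrable F := by
    refine Continuous.integrable_of_hasCompactSupport (by fun_prop) ?_
    exact HasCompactSupport.intro hc fun x hx => by simp [hF, hz x hx]
  have iF' : Integrable F' := by
    refine Continuous.integrable_of_hasCompactSupport (by fun_prop) ?_
    exact HasCompactSupport.intro hc fun x hx => by simp [hF', hz x hx]
  have hd : ∀ x, HasLineDerivAt ℝ F (F' x) x (Pi.single k 1) := by
    intro x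
    have h1 : HasDerivAt (fun t : ℝ => f (x + t • Pi.single k 1)) (p x) 0 :=
      hasLineDerivAt_pd hf x k
    have h2 : HasDerivAt (fun t : ℝ => p (x + t • Pi.single k 1)) (r x) 0 :=
      hasLineDerivAt_pd (contDiff_pd hf k) x k
    have re1 := Complex.reCLM.hasFDerivAt.comp_hasDerivAt (0 : ℝ) h1
    have im1 := Complex.imCLM.hasFDerivAt.comp_hasDerivAt (0 : ℝ) h1
    have re2 := Complex.reCLM.hasFDerivAt.comp_hasDerivAt (0 : ℝ) h2
    have im2 := Complex.imCLM.hasFDerivAt.comp_hasDerivAt (0 : ℝ) h2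
    have h3 : HasDerivAt (fun t : ℝ => φ ((x + t • (Pi.single k 1 : ι → ℝ)) k)) (φ' (x k)) 0 := by
      have e : (fun t : ℝ => φ ((x + t • (Pi.single k 1 : ι → ℝ)) k)) = fun t => φ (x k + t) := by
        funext t; simp
      rw [e]
      have := (hφ (x k + 0)).comp_const_add (x k) 0
      simpa using this
    have key := (((re1.mul re2).add (im1.mul im2)).neg).sub (h3.mul ((re1.pow 2).add (im1.pow 2)))
    refine key.congr_deriv ?_
    simp [hF']
  have h0 := integral_eq_zero_of_hasLineDerivAt iF iF' hd
  have i1 : Integrable fun x => (φ' (x k) - φ (x k) ^ 2) * ‖f x‖ ^ 2 :=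
    integrable_mul_normSq (Continuous.locallyIntegrable (by fun_prop)) fc hc
  have i2 : Integrable fun x => kinetic k f x := (integrable_kinetic hf hc k).re.neg
  have h1 : ∫ x, ((φ' (x k) - φ (x k) ^ 2) * ‖f x‖ ^ 2 + F' x) ≤ ∫ x, kinetic k f x := by
    refine integral_mono (i1.add iF') i2 fun x => ?_
    have e : kinetic k f x = -((f x).re * (r x).re + (f x).im * (r x).im) := by
      simp [kinetic, hr, hp]
    simp only [e, hn, hF']
    nlinarith [sq_nonneg ((p x).re + φ (x k) * (f x).re), sq_nonneg ((p x).im + φ (x k) * (f x).im)]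
  rw [integral_add i1 iF', h0, add_zero] at h1
  exact h1

end Kinetic

/-! ### Splitting off one particle by slicing. -/

section Slice

variable {ι : Type} [Fintype ι] [LinearOrder ι]

/-- The configuration of all particles with `x_k` taken from `z` and the others from `y`. -/
def merge (k : ι) (y : {j : ι // j ≠ k} → ℝ) (z : {j : ι // ¬ j ≠ k} → ℝ) : ι → ℝ :=
  (MeasurableEquiv.piEquivPiSubtypeProd (fun _ : ι => ℝ) (· ≠ k)).symm (y, z)

theorem merge_apply (k : ι) (y : {j : ι // j ≠ k} → ℝ) (z : {j : ι // ¬ j ≠ k} → ℝ) (i : ι) :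
    merge k y z i = if h : i ≠ k then y ⟨i, h⟩ else z ⟨i, h⟩ := rfl

theorem merge_coe (k : ι) (y : {j : ι // j ≠ k} → ℝ) (z : {j : ι // ¬ j ≠ k} → ℝ)
    (i : {j : ι // j ≠ k}) : merge k y z i = y i := by
  simp [merge_apply, i.2]

/-- The `DecidableEq` instance is arbitrary, so that the one coming from the linear order on the
subtype is covered. -/
theorem merge_update (k : ι) [DecidableEq {j : ι // j ≠ k}] (y : {j : ι // j ≠ k} → ℝ)
    (z : {j : ι // ¬ j ≠ k} → ℝ)
    (i : {j : ι // j ≠ k}) (t : ℝ) :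
    merge k (Function.update y i t) z = Function.update (merge k y z) i t := by
  funext l
  by_cases hl : l ≠ k
  · rw [show l = ((⟨l, hl⟩ : {j : ι // j ≠ k}) : ι) from rfl, merge_coe]
    by_cases h : (⟨l, hl⟩ : {j : ι // j ≠ k}) = i
    · rw [h]; simp
    · rw [Function.update_of_ne h, Function.update_of_ne, merge_coe]
      exact fun h' => h (Subtype.ext h')
  · have h' : l ≠ i := fun h' => hl (h' ▸ i.2)
    rw [Function.update_of_ne h', merge_apply, merge_apply, dif_neg hl, dif_neg hl]

theorem contDiff_merge (k : ι) (z : {j : ι // ¬ j ≠ k} → ℝ) :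
    ContDiff ℝ ∞ fun y => merge k y z := by
  rw [contDiff_pi]
  intro i
  simp only [merge_apply]
  by_cases h : i ≠ k
  · simp only [dif_pos h]; exact contDiff_apply ℝ ℝ _
  · simp only [dif_neg h]; exact contDiff_const

theorem hasCompactSupport_slice {f : (ι → ℝ) → ℂ} (hc : HasCompactSupport f) (k : ι)
    (z : {j : ι // ¬ j ≠ k} → ℝ) : HasCompactSupport fun y => f (merge k y z) := by
  refine hc.comp_isClosedEmbedding (g := fun y => merge k y z) ?_
  have h : Function.LeftInverse (fun (x : ι → ℝ) (i : {j : ι // j ≠ k}) => x i)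
      fun y => merge k y z := fun y => funext fun i => merge_coe k y z i
  exact h.isClosedEmbedding (by fun_prop) (contDiff_merge k z).continuous

theorem pd_slice {f : (ι → ℝ) → ℂ} (hf : ContDiff ℝ ∞ f) (k : ι)
    [DecidableEq {j : ι // j ≠ k}] (z : {j : ι // ¬ j ≠ k} → ℝ)
    (i : {j : ι // j ≠ k}) :
    pd i (fun y => f (merge k y z)) = fun y => pd (i : ι) f (merge k y z) := by
  funext y
  have h1 := hasDerivAt_comp_update (f := fun y => f (merge k y z))
    (hf.comp (contDiff_merge k z)) y i (y i)
  have h2 := hasDerivAt_comp_update hf (merge k y z) i (y i)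
  simp only [merge_update] at h1
  rw [Function.update_eq_self] at h1
  have h3 := h1.unique h2
  rwa [← merge_update, Function.update_eq_self] at h3

/-- The interaction of particle `k` with the others. -/
def interaction (W : ι → ι → ℝ → ℝ) (k : ι) (x : ι → ℝ) : ℝ :=
  ∑ j : {j : ι // j ≠ k}, if (j : ι) < k then W j k (x j - x k) else W k j (x k - x j)

theorem potential_merge (Z : ℝ) (V : ι → ℝ → ℝ) (W : ι → ι → ℝ → ℝ) (k : ι)
    (y : {j : ι // j ≠ k} → ℝ) (z : {j : ι // ¬ j ≠ k} → ℝ) :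
    potential Z V W (merge k y z)
      = potential Z (fun j : {j : ι // j ≠ k} => V j) (fun i j => W i j) y
        - Z * V k (merge k y z k) + interaction W k (merge k y z) := by
  simp only [potential, interaction, Fintype.sum_eq_add_sum_subtype_ne _ k, merge_coe,
    Finset.sum_add_distrib, lt_irrefl, if_false]
  have e : (∑ j : {j : ι // j ≠ k}, if (j : ι) < k then W j k (y j - merge k y z k)
        else W k j (merge k y z k - y j))
      = (∑ j : {j : ι // j ≠ k}, if k < (j : ι) then W k j (merge k y z k - y j) else 0)
        + ∑ j : {j : ι // j ≠ k}, if (j : ι) < k then W j k (y j - merge k y z k) else 0 := by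
    rw [← Finset.sum_add_distrib]
    refine Finset.sum_congr rfl fun j _ => ?_
    rcases lt_or_gt_of_ne j.2 with h | h
    · simp [h, h.not_gt]
    · simp [h, h.not_gt]
  rw [e]
  simp only [Subtype.coe_lt_coe]
  ring

theorem energyDensity_slice (Z M : ℝ) (V : ι → ℝ → ℝ) (W : ι → ι → ℝ → ℝ) {f : (ι → ℝ) → ℂ}
    (hf : ContDiff ℝ ∞ f) (k : ι) (y : {j : ι // j ≠ k} → ℝ) (z : {j : ι // ¬ j ≠ k} → ℝ) :
    energyDensity Z M (fun j : {j : ι // j ≠ k} => V j) (fun i j => W i j)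
        (fun y => f (merge k y z)) y
      = energyDensity Z M V W f (merge k y z) - (1 / M) * kinetic k f (merge k y z)
        - (interaction W k (merge k y z) - Z * V k (merge k y z k)) * ‖f (merge k y z)‖ ^ 2 := by
  have hk : ∀ j : {j : ι // j ≠ k}, kinetic j (fun y => f (merge k y z)) y
      = kinetic (j : ι) f (merge k y z) := by
    intro j
    simp only [kinetic]
    rw [pd_slice hf, pd_slice (contDiff_pd hf _)]
  simp only [energyDensity, hk]
  rw [potential_merge, Fintype.sum_eq_add_sum_subtype_ne _ k]
  ring

theorem locallyIntegrable_interaction {W : ι → ι → ℝ → ℝ}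
    (hW : ∀ j k, j < k → LocallyIntegrable (W j k)) (k : ι) :
    LocallyIntegrable (interaction W k) := by
  unfold interaction
  refine locallyIntegrable_finsetSum _ fun j _ => ?_
  rcases lt_or_gt_of_ne j.2 with h | h
  · simpa [h] using locallyIntegrable_comp_sub (hW j k h) h.ne
  · simpa [h.not_gt] using locallyIntegrable_comp_sub (hW k j h) h.ne

/-- The energy is at least that of the system without particle `k`, plus the kinetic energy of
particle `k` and its interactions. -/
theorem integral_energyDensity_ge_without {Z M e : ℝ} {V : ι → ℝ → ℝ} {W : ι → ι → ℝ → ℝ}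
    (hV : ∀ j, LocallyIntegrable (V j)) (hW : ∀ j k, j < k → LocallyIntegrable (W j k)) (k : ι)
    (he : (e : EReal) ≤ groundEnergy (ι := {j : ι // j ≠ k}) Z M (fun j => V j) (fun i j => W i j))
    {f : (ι → ℝ) → ℂ} (hf : ContDiff ℝ ∞ f) (hc : HasCompactSupport f) :
    e * ∫ x, ‖f x‖ ^ 2 ≤ ∫ x, (energyDensity Z M V W f x - (1 / M) * kinetic k f x
        - (interaction W k x - Z * V k (x k)) * ‖f x‖ ^ 2) := by
  set A : (ι → ℝ) → ℝ := fun x => energyDensity Z M V W f x - (1 / M) * kinetic k f x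
        - (interaction W k x - Z * V k (x k)) * ‖f x‖ ^ 2 with hA
  have iA : Integrable A := by
    refine ((integrable_energyDensity hV hW hf hc).sub
      ((integrable_kinetic hf hc k).re.neg.const_mul (1 / M))).sub ?_
    refine integrable_mul_normSq ?_ hf.continuous hc
    exact (locallyIntegrable_interaction hW k).sub ((locallyIntegrable_comp_eval (hV k) k).smul Z)
  have iN : Integrable fun x => ‖f x‖ ^ 2 :=
    (continuous_normSq hf.continuous).integrable_of_hasCompactSupport (hasCompactSupport_normSq hc)
  have hmp := (volume_preserving_piEquivPiSubtypeProd (fun _ : ι => ℝ) (· ≠ k)).symm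
  have hme := (MeasurableEquiv.piEquivPiSubtypeProd (fun _ : ι => ℝ) (· ≠ k)).symm.measurableEmbedding
  have jA := (hmp.integrable_comp_emb hme).2 iA
  have jN := (hmp.integrable_comp_emb hme).2 iN
  -- Fubini: for each frozen `x_k` the slice of `f` is an unnormalized trial function of the
  -- remaining particles.
  rw [← hmp.integral_comp hme A, ← hmp.integral_comp hme fun x => ‖f x‖ ^ 2]
  rw [Measure.volume_eq_prod] at jA jN ⊢
  have eA := integral_prod_symm _ jA
  have eN := integral_prod_symm _ jN
  simp only [Function.comp_apply] at eA eN
  rw [eA, eN, ← integral_const_mul]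
  refine integral_mono (jN.integral_prod_right.const_mul e) jA.integral_prod_right fun z => ?_
  have h := mul_integral_le_integral_energyDensity (fun j : {j : ι // j ≠ k} => hV j)
    (fun i j hij => hW i j hij) he (hf.comp (contDiff_merge k z)) (hasCompactSupport_slice hc k z)
  refine h.trans (le_of_eq ?_)
  refine integral_congr_ae (Filter.Eventually.of_forall fun y => ?_)
  exact energyDensity_slice Z M V W hf k y z

/-- The continuous minorant `c` replaces the potentials, which are only locally integrable, and the
kinetic energy of particle `k`, so that the later comparison is pointwise. -/
theorem integral_energyDensity_ge {Z M e : ℝ} {V : ι → ℝ → ℝ} {W : ι → ι → ℝ → ℝ} (hM : 0 < M)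
    (hV : ∀ j, LocallyIntegrable (V j)) (hW : ∀ j k, j < k → LocallyIntegrable (W j k)) (k : ι)
    (he : (e : EReal) ≤ groundEnergy (ι := {j : ι // j ≠ k}) Z M (fun j => V j) (fun i j => W i j))
    {φ φ' : ℝ → ℝ} (hφ : ∀ t, HasDerivAt φ (φ' t) t) (hφ' : Continuous φ')
    {c : (ι → ℝ) → ℝ} (hcc : Continuous c)
    (hcle : ∀ x, c x ≤ (1 / M) * (φ' (x k) - φ (x k) ^ 2) - Z * V k (x k) + interaction W k x)
    {f : (ι → ℝ) → ℂ} (hf : ContDiff ℝ ∞ f) (hc : HasCompactSupport f) :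
    ∫ x, (e + c x) * ‖f x‖ ^ 2 ≤ ∫ x, energyDensity Z M V W f x := by
  have hφc : Continuous φ := continuous_iff_continuousAt.2 fun t => (hφ t).continuousAt
  have iN : Integrable fun x => ‖f x‖ ^ 2 :=
    (continuous_normSq hf.continuous).integrable_of_hasCompactSupport (hasCompactSupport_normSq hc)
  have iE := integrable_energyDensity (M := M) (Z := Z) hV hW hf hc
  have iK : Integrable fun x => (1 / M) * kinetic k f x :=
    (integrable_kinetic hf hc k).re.neg.const_mul (1 / M)
  have iI : Integrable fun x => (interaction W k x - Z * V k (x k)) * ‖f x‖ ^ 2 :=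
    integrable_mul_normSq ((locallyIntegrable_interaction hW k).sub
      ((locallyIntegrable_comp_eval (hV k) k).smul Z)) hf.continuous hc
  have iφ : Integrable fun x => (φ' (x k) - φ (x k) ^ 2) * ‖f x‖ ^ 2 :=
    integrable_mul_normSq (Continuous.locallyIntegrable (by fun_prop)) hf.continuous hc
  have ic : Integrable fun x => c x * ‖f x‖ ^ 2 :=
    integrable_mul_normSq hcc.locallyIntegrable hf.continuous hc
  have h1 := integral_energyDensity_ge_without hV hW k he hf hc
  have h0 := integral_sub (iE.sub iK) iI
  simp only [Pi.sub_apply] at h0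
  rw [h0, integral_sub iE iK, integral_const_mul] at h1
  have h2 := integral_riccati_le_integral_kinetic hφ hφ' hf hc k
  have h3 : ∫ x, c x * ‖f x‖ ^ 2 ≤ ∫ x, ((1 / M) * ((φ' (x k) - φ (x k) ^ 2) * ‖f x‖ ^ 2)
      + (interaction W k x - Z * V k (x k)) * ‖f x‖ ^ 2) := by
    refine integral_mono ic ((iφ.const_mul _).add iI) fun x => ?_
    have := mul_le_mul_of_nonneg_right (hcle x) (sq_nonneg ‖f x‖)
    simp only
    linarith
  rw [integral_add (iφ.const_mul _) iI, integral_const_mul] at h3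
  have h4 : (1 / M) * ∫ x, (φ' (x k) - φ (x k) ^ 2) * ‖f x‖ ^ 2
      ≤ (1 / M) * ∫ x, kinetic k f x := by gcongr
  have e : ∫ x, (e + c x) * ‖f x‖ ^ 2 = e * (∫ x, ‖f x‖ ^ 2) + ∫ x, c x * ‖f x‖ ^ 2 := by
    rw [← integral_const_mul, ← integral_add (iN.const_mul e) ic]
    simp only [add_mul]
  linarith

end Slice

/-! ### Localization and the balance of attraction and repulsion. -/

section Localization

variable {ι : Type} [Fintype ι] [LinearOrder ι]

/-- Used for `g_k` in a direction `j ≠ k`, along which the weight does not vary. -/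
theorem kinetic_of_const_mul {f u : (ι → ℝ) → ℂ} (hf : ContDiff ℝ ∞ f) (hu : ContDiff ℝ ∞ u)
    (x : ι → ℝ) (j : ι) (c : ℝ)
    (h : ∀ t, f (Function.update x j t) = (c : ℂ) * u (Function.update x j t)) :
    kinetic j f x = c ^ 2 * kinetic j u x := by
  have h1 : ∀ t, pd j f (Function.update x j t) = (c : ℂ) * pd j u (Function.update x j t) := by
    intro t
    have := hasDerivAt_comp_update hf x j t
    simp only [h] at this
    exact this.unique ((hasDerivAt_comp_update hu x j t).const_mul _)
  have h2 : pd j (pd j f) x = (c : ℂ) * pd j (pd j u) x := by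
    have := hasDerivAt_comp_update (contDiff_pd hf j) x j (x j)
    simp only [h1] at this
    simpa using
      this.unique ((hasDerivAt_comp_update (contDiff_pd hu j) x j (x j)).const_mul (c : ℂ))
  have h0 : f x = (c : ℂ) * u x := by simpa using h (x j)
  simp only [kinetic, h2, h0, map_mul, Complex.conj_ofReal]
  have : (c : ℂ) * (starRingEnd ℂ) (u x) * ((c : ℂ) * pd j (pd j u) x)
      = ((c ^ 2 : ℝ) : ℂ) * ((starRingEnd ℂ) (u x) * pd j (pd j u) x) := by
    push_cast; ring
  rw [this, Complex.re_ofReal_mul]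
  ring

/-- For `G = √(t² + a)` one has `G G' = t` and `G G'' = a/(t² + a)`. The cross term does not depend
on `a`, hence cancels between `f` and `g_j`, whose weights differ only in `a`. -/
theorem kinetic_of_sqrt_mul {f u : (ι → ℝ) → ℂ} (hf : ContDiff ℝ ∞ f) (hu : ContDiff ℝ ∞ u)
    (x : ι → ℝ) (j : ι) {a : ℝ} (ha : 0 < a)
    (h : ∀ t, f (Function.update x j t)
      = (Real.sqrt (t ^ 2 + a) : ℂ) * u (Function.update x j t)) :
    kinetic j f x = (x j ^ 2 + a) * kinetic j u x
      - 2 * x j * ((starRingEnd ℂ) (u x) * pd j u x).re - a / (x j ^ 2 + a) * ‖u x‖ ^ 2 := by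
  have hG0 : ∀ t : ℝ, 0 < Real.sqrt (t ^ 2 + a) := fun t => Real.sqrt_pos.2 (by positivity)
  have hG2 : ∀ t : ℝ, Real.sqrt (t ^ 2 + a) ^ 2 = t ^ 2 + a := fun t => Real.sq_sqrt (by positivity)
  have hG : ∀ t : ℝ, HasDerivAt (fun t : ℝ => Real.sqrt (t ^ 2 + a))
      (t / Real.sqrt (t ^ 2 + a)) t := by
    intro t
    have h : HasDerivAt (fun t : ℝ => t ^ 2 + a) (2 * t) t := by
      simpa using (hasDerivAt_pow 2 t).add_const a
    refine (h.sqrt (by positivity)).congr_deriv ?_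
    have := hG0 t
    field_simp
  have hG' : ∀ t : ℝ, HasDerivAt (fun t : ℝ => t / Real.sqrt (t ^ 2 + a))
      (a / Real.sqrt (t ^ 2 + a) ^ 3) t := by
    intro t
    refine ((hasDerivAt_id' t).div (hG t) (hG0 t).ne').congr_deriv ?_
    have := hG0 t
    field_simp
    rw [hG2]
    ring
  have h1 : ∀ t, pd j f (Function.update x j t)
      = ((t / Real.sqrt (t ^ 2 + a) : ℝ) : ℂ) * u (Function.update x j t)
        + (Real.sqrt (t ^ 2 + a) : ℂ) * pd j u (Function.update x j t) := by
    intro t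
    have := hasDerivAt_comp_update hf x j t
    simp only [h] at this
    exact this.unique ((hG t).ofReal_comp.mul (hasDerivAt_comp_update hu x j t))
  have h2 : pd j (pd j f) x
      = ((a / Real.sqrt (x j ^ 2 + a) ^ 3 : ℝ) : ℂ) * u x
        + 2 * (((x j / Real.sqrt (x j ^ 2 + a) : ℝ) : ℂ) * pd j u x)
        + (Real.sqrt (x j ^ 2 + a) : ℂ) * pd j (pd j u) x := by
    have := hasDerivAt_comp_update (contDiff_pd hf j) x j (x j)
    simp only [h1] at this
    have h3 := this.unique (((hG' (x j)).ofReal_comp.mul (hasDerivAt_comp_update hu x j (x j))).add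
      ((hG (x j)).ofReal_comp.mul (hasDerivAt_comp_update (contDiff_pd hu j) x j (x j))))
    rw [Function.update_eq_self] at h3
    rw [h3]
    ring
  have h0 : f x = (Real.sqrt (x j ^ 2 + a) : ℂ) * u x := by simpa using h (x j)
  have hn : (starRingEnd ℂ) (u x) * u x = ((‖u x‖ ^ 2 : ℝ) : ℂ) := by
    rw [mul_comm, Complex.mul_conj, Complex.normSq_eq_norm_sq]
  simp only [kinetic, h2, h0, map_mul, Complex.conj_ofReal]
  have hg0 := hG0 (x j)
  have hg2 := hG2 (x j)
  set G := Real.sqrt (x j ^ 2 + a)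
  rw [← hg2]
  have e : (G : ℂ) * (starRingEnd ℂ) (u x) * (((a / G ^ 3 : ℝ) : ℂ) * u x
        + 2 * (((x j / G : ℝ) : ℂ) * pd j u x) + (G : ℂ) * pd j (pd j u) x)
      = ((G * (a / G ^ 3) * ‖u x‖ ^ 2 : ℝ) : ℂ)
        + ((2 * (G * (x j / G)) : ℝ) : ℂ) * ((starRingEnd ℂ) (u x) * pd j u x)
        + ((G ^ 2 : ℝ) : ℂ) * ((starRingEnd ℂ) (u x) * pd j (pd j u) x) := by
    rw [Complex.ofReal_mul (G * (a / G ^ 3)), ← hn]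
    push_cast
    ring
  rw [e, Complex.add_re, Complex.add_re, Complex.ofReal_re, Complex.re_ofReal_mul,
    Complex.re_ofReal_mul]
  field_simp
  ring

/-- The localization formula for the weights `√(x_k² + R²)`. -/
theorem sum_energyDensity_le {Z M R : ℝ} (hM : 0 < M) (hR : 0 < R) {V : ι → ℝ → ℝ}
    {W : ι → ι → ℝ → ℝ} {u f : (ι → ℝ) → ℂ} {g : ι → (ι → ℝ) → ℂ}
    (hu : ContDiff ℝ ∞ u) (hf : ContDiff ℝ ∞ f) (hg : ∀ k, ContDiff ℝ ∞ (g k))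
    (hfu : ∀ x, f x = (Real.sqrt (∑ k, (x k ^ 2 + R ^ 2)) : ℂ) * u x)
    (hgu : ∀ k x, g k x = (Real.sqrt (x k ^ 2 + R ^ 2) : ℂ) * u x) (x : ι → ℝ) :
    ∑ k, energyDensity Z M V W (g k) x
      ≤ energyDensity Z M V W f x + (1 / M) * (Fintype.card ι * ‖u x‖ ^ 2) := by
  have hkin : ∀ j, ∑ k, kinetic j (g k) x ≤ kinetic j f x + ‖u x‖ ^ 2 := by
    intro j
    set b := ∑ k : {k : ι // k ≠ j}, (x k ^ 2 + R ^ 2) with hb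
    have hb0 : 0 ≤ b := Finset.sum_nonneg fun k _ => by positivity
    have h1 := kinetic_of_sqrt_mul (hg j) hu x j (a := R ^ 2) (by positivity)
      (fun t => by rw [hgu]; simp)
    have h2 := kinetic_of_sqrt_mul hf hu x j (a := R ^ 2 + b) (by positivity) (fun t => by
      rw [hfu, Fintype.sum_eq_add_sum_subtype_ne _ j, Function.update_self, add_assoc]
      congr 5
      refine Finset.sum_congr rfl fun k _ => ?_
      rw [Function.update_of_ne k.2])
    have h3 : ∀ k : {k : ι // k ≠ j}, kinetic j (g k) x = (x k ^ 2 + R ^ 2) * kinetic j u x := by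
      intro k
      rw [kinetic_of_const_mul (hg k) hu x j (Real.sqrt (x k ^ 2 + R ^ 2))
        (fun t => by rw [hgu, Function.update_of_ne k.2]), Real.sq_sqrt (by positivity)]
    rw [Fintype.sum_eq_add_sum_subtype_ne _ j, h1, h2, Finset.sum_congr rfl fun k _ => h3 k,
      ← Finset.sum_mul, ← hb]
    -- Only the terms `G G'' |u|²` survive, and for `f` this is at most `|u|²`: each direction costs
    -- one `|u|²`.
    have h4 : (R ^ 2 + b) / (x j ^ 2 + (R ^ 2 + b)) * ‖u x‖ ^ 2 ≤ 1 * ‖u x‖ ^ 2 := by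
      gcongr
      rw [div_le_one (by positivity)]
      nlinarith [sq_nonneg (x j)]
    have h5 : 0 ≤ R ^ 2 / (x j ^ 2 + R ^ 2) * ‖u x‖ ^ 2 := by positivity
    linarith
  have hpot : ∑ k, potential Z V W x * ‖g k x‖ ^ 2 = potential Z V W x * ‖f x‖ ^ 2 := by
    rw [← Finset.mul_sum, hfu]
    simp only [hgu, norm_mul, mul_pow, Complex.norm_real, Real.norm_eq_abs, sq_abs]
    rw [← Finset.sum_mul, Real.sq_sqrt (Finset.sum_nonneg fun k _ => by positivity)]
    congr 2
    exact Finset.sum_congr rfl fun k _ => Real.sq_sqrt (by positivity)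
  simp only [energyDensity]
  rw [Finset.sum_add_distrib, hpot, ← Finset.mul_sum, Finset.sum_comm]
  have : ∑ j, ∑ k, kinetic j (g k) x ≤ ∑ j, kinetic j f x + Fintype.card ι * ‖u x‖ ^ 2 := by
    calc _ ≤ ∑ j, (kinetic j f x + ‖u x‖ ^ 2) := Finset.sum_le_sum fun j _ => hkin j
      _ = _ := by rw [Finset.sum_add_distrib]; simp
  have h := mul_le_mul_of_nonneg_left this (by positivity : 0 ≤ 1 / M)
  rw [mul_add] at h
  linarith

/-- With `a`, `b` the two weights and `c` the regularized distance, `n ≤ R²` gives `c² ≤ 2(a² +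
b²)`, and so `c(a + b)/2 ≤ (c² + (a + b)²)/4 ≤ a² + b²`. -/
theorem half_add_le_mul_inv_sqrt {R n s t : ℝ} (hR : 0 < R) (hn : 0 < n) (hnR : n ≤ R ^ 2) :
    (Real.sqrt (s ^ 2 + R ^ 2) + Real.sqrt (t ^ 2 + R ^ 2)) / 2
      ≤ 1 / Real.sqrt ((s - t) ^ 2 + 2 * n) * ((s ^ 2 + R ^ 2) + (t ^ 2 + R ^ 2)) := by
  set a := Real.sqrt (s ^ 2 + R ^ 2)
  set b := Real.sqrt (t ^ 2 + R ^ 2)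
  have ha0 : 0 ≤ a := Real.sqrt_nonneg _
  have hb0 : 0 ≤ b := Real.sqrt_nonneg _
  have ha : a ^ 2 = s ^ 2 + R ^ 2 := Real.sq_sqrt (by positivity)
  have hb : b ^ 2 = t ^ 2 + R ^ 2 := Real.sq_sqrt (by positivity)
  set c := Real.sqrt ((s - t) ^ 2 + 2 * n)
  have hc0 : 0 < c := Real.sqrt_pos.2 (by positivity)
  have hc : c ^ 2 = (s - t) ^ 2 + 2 * n := Real.sq_sqrt (by positivity)
  rw [← ha, ← hb, one_div, ← div_eq_inv_mul, le_div_iff₀ hc0]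
  have h1 : c ^ 2 ≤ 2 * (a ^ 2 + b ^ 2) := by
    rw [hc, ha, hb]; nlinarith [sq_nonneg (s + t)]
  have h2 : (a + b) ^ 2 ≤ 2 * (a ^ 2 + b ^ 2) := by nlinarith [sq_nonneg (a - b)]
  nlinarith [sq_nonneg (a + b - c)]

theorem sum_pairs_ge {R n : ℝ} (hR : 0 < R) (hn : 0 < n) (hnR : n ≤ R ^ 2) (x : ι → ℝ) :
    ((Fintype.card ι : ℝ) - 1) / 2 * ∑ k, Real.sqrt (x k ^ 2 + R ^ 2)
      ≤ ∑ k, (∑ j : {j : ι // j ≠ k}, 1 / Real.sqrt ((x j - x k) ^ 2 + 2 * n))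
        * (x k ^ 2 + R ^ 2) := by
  set g : ι → ℝ := fun k => Real.sqrt (x k ^ 2 + R ^ 2) with hg
  set P : ι → ι → ℝ := fun k j =>
    if j = k then 0 else 1 / Real.sqrt ((x j - x k) ^ 2 + 2 * n) * (x k ^ 2 + R ^ 2) with hP
  have h1 : ∑ k, (∑ j : {j : ι // j ≠ k}, 1 / Real.sqrt ((x j - x k) ^ 2 + 2 * n))
        * (x k ^ 2 + R ^ 2) = ∑ k, ∑ j, P k j := by
    refine Finset.sum_congr rfl fun k _ => ?_
    rw [Fintype.sum_eq_add_sum_subtype_ne _ k, Finset.sum_mul]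
    simp only [hP, if_true, zero_add]
    exact Finset.sum_congr rfl fun j _ => by rw [if_neg j.2]
  have h2 : ∑ k, ∑ j, P k j = (1 / 2) * ∑ k, ∑ j, (P k j + P j k) := by
    simp only [Finset.sum_add_distrib]
    rw [Finset.sum_comm (f := fun k j => P j k)]
    ring
  -- The subtracted diagonal makes both sides vanish at `j = k`; it turns the factor `N` into `N -
  -- 1`.
  have h3 : ∀ k j, (g j + g k) / 2 - (if j = k then g k else 0) ≤ P k j + P j k := by
    intro k j
    by_cases h : j = k
    · subst h; simp [hP]
    · simp only [hP, if_neg h, if_neg (Ne.symm h)]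
      have := half_add_le_mul_inv_sqrt (s := x j) (t := x k) hR hn hnR
      have e : (x k - x j) ^ 2 = (x j - x k) ^ 2 := by ring
      rw [e, sub_zero, ← mul_add]
      linarith
  have h4 : ∑ k, ∑ j, ((g j + g k) / 2 - (if j = k then g k else 0))
      = (Fintype.card ι : ℝ) * ∑ k, g k - ∑ k, g k := by
    simp only [Finset.sum_sub_distrib, ← Finset.sum_div, Finset.sum_add_distrib]
    simp [← Finset.mul_sum]
  rw [h1, h2]
  have h5 := Finset.sum_le_sum fun k (_ : k ∈ Finset.univ) =>
    Finset.sum_le_sum fun j (_ : j ∈ Finset.univ) => h3 k j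
  rw [h4] at h5
  linarith

/-- If the repulsion of the other particles outweighs the effective attraction `Z' / √(t² + R²)`
and the localization error, then the energy cannot be lowered below that of all the systems with
one particle removed. -/
theorem le_integral_energyDensity {Z Z' M R n e : ℝ} {V : ι → ℝ → ℝ} {W : ι → ι → ℝ → ℝ}
    [Nonempty ι] (hZ : 0 ≤ Z) (hM : 0 < M) (hR : 0 < R) (hn : 0 < n) (hnR : n ≤ R ^ 2)
    (hV : ∀ j, LocallyIntegrable (V j)) (hW : ∀ j k, j < k → LocallyIntegrable (W j k))
    {v φ φ' : ℝ → ℝ} (hVv : ∀ j t, V j t ≤ v t)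
    (hWw : ∀ j k, j < k → ∀ t, 1 / Real.sqrt (t ^ 2 + 2 * n) ≤ W j k t)
    (hφ : ∀ t, HasDerivAt φ (φ' t) t) (hφ' : Continuous φ')
    (hv : ∀ t, Z * v t - Z' / Real.sqrt (t ^ 2 + R ^ 2) ≤ (1 / M) * (φ' t - φ t ^ 2))
    (hcard : Z' + (1 / M) / R ≤ ((Fintype.card ι : ℝ) - 1) / 2)
    (he : ∀ k : ι, (e : EReal)
      ≤ groundEnergy (ι := {j : ι // j ≠ k}) Z M (fun j => V j) (fun i j => W i j))
    {f : (ι → ℝ) → ℂ} (hf : ContDiff ℝ ∞ f) (hc : HasCompactSupport f) :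
    e * ∫ x, ‖f x‖ ^ 2 ≤ ∫ x, energyDensity Z M V W f x := by
  have hS0 : ∀ x : ι → ℝ, 0 < ∑ k, (x k ^ 2 + R ^ 2) := fun x =>
    Finset.sum_pos (fun k _ => by positivity) Finset.univ_nonempty
  have hg0 : ∀ t : ℝ, 0 < Real.sqrt (t ^ 2 + R ^ 2) := fun t => Real.sqrt_pos.2 (by positivity)
  have hw0 : ∀ t : ℝ, 0 < Real.sqrt (t ^ 2 + 2 * n) := fun t => Real.sqrt_pos.2 (by positivity)
  set ρ : (ι → ℝ) → ℝ := fun x => Real.sqrt (∑ k, (x k ^ 2 + R ^ 2)) with hρ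
  have hρ0 : ∀ x, 0 < ρ x := fun x => Real.sqrt_pos.2 (hS0 x)
  have hρs : ContDiff ℝ ∞ ρ :=
    ContDiff.sqrt (by fun_prop) fun x => (hS0 x).ne'
  -- Dividing by `ρ` makes the functions `√(x_k² + R²) u` a quadratic partition of `f`.
  set u : (ι → ℝ) → ℂ := fun x => (((ρ x)⁻¹ : ℝ) : ℂ) * f x with hu
  have hus : ContDiff ℝ ∞ u :=
    (Complex.ofRealCLM.contDiff.comp (hρs.inv fun x => (hρ0 x).ne')).mul hf
  have huc : HasCompactSupport u := hc.mul_left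
  have hgs : ∀ k : ι, ContDiff ℝ ∞ fun x : ι → ℝ => ((Real.sqrt (x k ^ 2 + R ^ 2) : ℝ) : ℂ) :=
    fun k => Complex.ofRealCLM.contDiff.comp
      (ContDiff.sqrt (by fun_prop) fun x => by positivity)
  set g : ι → (ι → ℝ) → ℂ := fun k x => ((Real.sqrt (x k ^ 2 + R ^ 2) : ℝ) : ℂ) * u x with hg
  have hgs' : ∀ k, ContDiff ℝ ∞ (g k) := fun k => (hgs k).mul hus
  have hgc : ∀ k, HasCompactSupport (g k) := fun k => huc.mul_left
  have hfu : ∀ x, f x = ((ρ x : ℝ) : ℂ) * u x := fun x => by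
    have : ((ρ x : ℝ) : ℂ) ≠ 0 := by exact_mod_cast (hρ0 x).ne'
    simp only [hu, Complex.ofReal_inv]
    field_simp
  set c : ι → (ι → ℝ) → ℝ := fun k x => -(Z' / Real.sqrt (x k ^ 2 + R ^ 2))
    + ∑ j : {j : ι // j ≠ k}, 1 / Real.sqrt ((x j - x k) ^ 2 + 2 * n) with hcdef
  have hcc : ∀ k, Continuous (c k) := by
    intro k
    refine Continuous.add (Continuous.neg ?_) (continuous_finsetSum _ fun j _ => ?_)
    · exact Continuous.div continuous_const (by fun_prop) fun x => (hg0 _).ne'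
    · exact Continuous.div continuous_const (by fun_prop) fun x => (hw0 _).ne'
  have hcle : ∀ k x, c k x
      ≤ (1 / M) * (φ' (x k) - φ (x k) ^ 2) - Z * V k (x k) + interaction W k x := by
    intro k x
    have h1 := hv (x k)
    have h2 : Z * V k (x k) ≤ Z * v (x k) := mul_le_mul_of_nonneg_left (hVv k _) hZ
    have h3 : ∑ j : {j : ι // j ≠ k}, 1 / Real.sqrt ((x j - x k) ^ 2 + 2 * n)
        ≤ interaction W k x := by
      refine Finset.sum_le_sum fun j _ => ?_
      split_ifs with h
      · exact hWw j k h _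
      · have e : (x j - x k) ^ 2 = (x k - x j) ^ 2 := by ring
        rw [e]
        exact hWw k j (lt_of_le_of_ne (not_lt.1 h) (Ne.symm j.2)) _
    simp only [hcdef]
    linarith
  have hlow := fun k => integral_energyDensity_ge hM hV hW k (he k) hφ hφ' (hcc k) (hcle k)
    (hgs' k) (hgc k)
  have iE := fun k => integrable_energyDensity (Z := Z) (M := M) hV hW (hgs' k) (hgc k)
  have iL : ∀ k, Integrable fun x => (e + c k x) * ‖g k x‖ ^ 2 := fun k =>
    integrable_mul_normSq (continuous_const.add (hcc k)).locallyIntegrable (hgs' k).continuous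
      (hgc k)
  have iN : Integrable fun x => ‖f x‖ ^ 2 :=
    (continuous_normSq hf.continuous).integrable_of_hasCompactSupport (hasCompactSupport_normSq hc)
  have iU : Integrable fun x => ‖u x‖ ^ 2 :=
    (continuous_normSq hus.continuous).integrable_of_hasCompactSupport
      (hasCompactSupport_normSq huc)
  have iEf := integrable_energyDensity (Z := Z) (M := M) hV hW hf hc
  have hup : ∑ k, ∫ x, energyDensity Z M V W (g k) x
      ≤ ∫ x, (energyDensity Z M V W f x + (1 / M) * (Fintype.card ι * ‖u x‖ ^ 2)) := by
    rw [← integral_finsetSum _ fun k _ => iE k]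
    refine integral_mono (integrable_finsetSum _ fun k _ => iE k)
      (iEf.add ((iU.const_mul _).const_mul _)) fun x => ?_
    exact sum_energyDensity_le hM hR hus hf hgs' hfu (fun k x => rfl) x
  have hdown : ∫ x, (e * ‖f x‖ ^ 2 + (1 / M) * (Fintype.card ι * ‖u x‖ ^ 2))
      ≤ ∑ k, ∫ x, (e + c k x) * ‖g k x‖ ^ 2 := by
    rw [← integral_finsetSum _ fun k _ => iL k]
    refine integral_mono ((iN.const_mul e).add ((iU.const_mul _).const_mul _))
      (integrable_finsetSum _ fun k _ => iL k) fun x => ?_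
    have hgn : ∀ k, ‖g k x‖ ^ 2 = (x k ^ 2 + R ^ 2) * ‖u x‖ ^ 2 := fun k => by
      simp only [hg, norm_mul, mul_pow, Complex.norm_real, Real.norm_eq_abs, sq_abs]
      rw [Real.sq_sqrt (by positivity)]
    have hfn : ‖f x‖ ^ 2 = (∑ k, (x k ^ 2 + R ^ 2)) * ‖u x‖ ^ 2 := by
      rw [hfu x, norm_mul, mul_pow, Complex.norm_real, Real.norm_eq_abs, sq_abs,
        Real.sq_sqrt (hS0 x).le]
    have h1 : ∑ k, (e + c k x) * ‖g k x‖ ^ 2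
        = e * ‖f x‖ ^ 2 + (∑ k, c k x * (x k ^ 2 + R ^ 2)) * ‖u x‖ ^ 2 := by
      rw [hfn, Finset.sum_mul, Finset.sum_mul, Finset.mul_sum, ← Finset.sum_add_distrib]
      refine Finset.sum_congr rfl fun k _ => ?_
      rw [hgn]
      ring
    have h2 : ∑ k, c k x * (x k ^ 2 + R ^ 2)
        = -Z' * ∑ k, Real.sqrt (x k ^ 2 + R ^ 2)
          + ∑ k, (∑ j : {j : ι // j ≠ k}, 1 / Real.sqrt ((x j - x k) ^ 2 + 2 * n))
            * (x k ^ 2 + R ^ 2) := by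
      rw [Finset.mul_sum, ← Finset.sum_add_distrib]
      refine Finset.sum_congr rfl fun k _ => ?_
      have h := hg0 (x k)
      have h' : Real.sqrt (x k ^ 2 + R ^ 2) ^ 2 = x k ^ 2 + R ^ 2 := Real.sq_sqrt (by positivity)
      simp only [hcdef]
      rw [add_mul]
      congr 1
      nth_rewrite 2 [← h']
      field_simp
    have h3 := sum_pairs_ge hR hn hnR x
    have h4 : (Fintype.card ι : ℝ) * R ≤ ∑ k, Real.sqrt (x k ^ 2 + R ^ 2) := by
      calc (Fintype.card ι : ℝ) * R = ∑ _k : ι, R := by simp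
        _ ≤ _ := Finset.sum_le_sum fun k _ => Real.le_sqrt_of_sq_le (by nlinarith [sq_nonneg (x k)])
    -- The surplus of repulsion over attraction, at least `(1/M)/R` per unit of `∑_k √(x_k² + R²) ≥
    -- N R`, covers the localization error.
    have h5 : (1 / M) * Fintype.card ι ≤ ∑ k, c k x * (x k ^ 2 + R ^ 2) := by
      have h6 : (1 / M) / R * ∑ k, Real.sqrt (x k ^ 2 + R ^ 2)
          ≤ (((Fintype.card ι : ℝ) - 1) / 2 - Z') * ∑ k, Real.sqrt (x k ^ 2 + R ^ 2) := by
        refine mul_le_mul_of_nonneg_right (by linarith) (Finset.sum_nonneg fun k _ => (hg0 _).le)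
      have h7 : (1 / M) * Fintype.card ι ≤ (1 / M) / R * ∑ k, Real.sqrt (x k ^ 2 + R ^ 2) := by
        calc (1 / M) * Fintype.card ι = (1 / M) / R * (Fintype.card ι * R) := by field_simp
          _ ≤ _ := by gcongr
      rw [h2]
      linarith
    simp only [h1]
    have := mul_le_mul_of_nonneg_right h5 (sq_nonneg ‖u x‖)
    linarith
  have h := hdown.trans ((Finset.sum_le_sum fun k _ => hlow k).trans hup)
  rw [integral_add (iN.const_mul e) ((iU.const_mul _).const_mul _),
    integral_add iEf ((iU.const_mul _).const_mul _), integral_const_mul e] at h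
  linarith

end Localization

/-! ### Absence of bound states and the choice of parameters. -/

/-- A bound state would give a trial function with energy below the smallest of the `N` energies
`groundEnergyOmit`. A real `e` strictly in between, which also avoids infinite values, contradicts
`le_integral_energyDensity`. -/
theorem not_hasBoundState {N : ℕ} {Z Z' M R n : ℝ} {V : Fin N → ℝ → ℝ} {W : Fin N → Fin N → ℝ → ℝ}
    (hN : 0 < N) (hZ : 0 ≤ Z) (hM : 0 < M) (hR : 0 < R) (hn : 0 < n) (hnR : n ≤ R ^ 2)
    (hV : ∀ j, LocallyIntegrable (V j)) (hW : ∀ j k, j < k → LocallyIntegrable (W j k))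
    {v φ φ' : ℝ → ℝ} (hVv : ∀ j t, V j t ≤ v t)
    (hWw : ∀ j k, j < k → ∀ t, 1 / Real.sqrt (t ^ 2 + 2 * n) ≤ W j k t)
    (hφ : ∀ t, HasDerivAt φ (φ' t) t) (hφ' : Continuous φ')
    (hv : ∀ t, Z * v t - Z' / Real.sqrt (t ^ 2 + R ^ 2) ≤ (1 / M) * (φ' t - φ t ^ 2))
    (hcard : Z' + (1 / M) / R ≤ ((N : ℝ) - 1) / 2) :
    ¬ HasBoundState Z M V W := by
  intro h
  have : Nonempty (Fin N) := ⟨⟨0, hN⟩⟩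
  obtain ⟨k, hk⟩ := Finite.exists_min fun k => groundEnergyOmit Z M V W k
  obtain ⟨⟨f, hf, hc, h1⟩, hlt⟩ := iInf_lt_iff.1 (h k)
  obtain ⟨e, hfe, hek⟩ := EReal.lt_iff_exists_real_btwn.1 hlt
  rw [EReal.coe_lt_coe_iff, re_integral_hamiltonian hV hW hf hc] at hfe
  have := le_integral_energyDensity hZ hM hR hn hnR hV hW hVv hWw hφ hφ' hv
    (by simpa using hcard) (fun i => hek.le.trans (hk i)) hf hc
  rw [h1, mul_one] at this
  exact absurd hfe (not_lt.2 this)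

theorem le_of_scaled_landauPotential_le {ν : ℕ} (hν : 1 ≤ ν) {w x : ℝ}
    (h : 1 / Real.sqrt 2 * landauPotential (ν - 1) (x / Real.sqrt 2) ≤ w) :
    1 / Real.sqrt (x ^ 2 + 2 * ν) ≤ w := by
  refine le_trans ?_ h
  have h1 := le_landauPotential (ν - 1) (x / Real.sqrt 2)
  have h2 : ((ν - 1 : ℕ) : ℝ) + 1 = ν := by rw [Nat.cast_sub hν]; simp
  rw [h2] at h1
  have h3 : x ^ 2 + 2 * ν = 2 * ((x / Real.sqrt 2) ^ 2 + ν) := by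
    rw [div_pow, Real.sq_sqrt (by norm_num)]; ring
  rw [h3, Real.sqrt_mul (by norm_num), ← one_div_mul_one_div]
  gcongr

theorem landauPotential_le {μ ν : ℕ} (hν : 1 ≤ ν) (hνμ : ν ≤ 2 * μ) (x : ℝ) :
    landauPotential μ x ≤ 1 / Real.sqrt (x ^ 2 + ν / 2) := by
  -- `1 ≤ ν ≤ 2μ` forces `μ ≥ 1`, as the upper Jensen bound requires.
  obtain ⟨m, rfl⟩ : ∃ m, μ = m + 1 := ⟨μ - 1, by omega⟩
  refine (landauPotential_succ_le m x).trans ?_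
  have h1 : (1 : ℝ) ≤ ν := by exact_mod_cast hν
  have h2 : (ν : ℝ) ≤ 2 * (m + 1) := by exact_mod_cast hνμ
  have : 0 < Real.sqrt (x ^ 2 + (ν : ℝ) / 2) := Real.sqrt_pos.2 (by positivity)
  gcongr
  linarith

end StrongField

end

theorem theorem1 :
    ∃ a₁ : ℝ, 0 < a₁ ∧ ∃ a₂ : ℝ → ℝ → ℝ, (∀ γ C : ℝ, 0 < a₂ γ C) ∧
      ∀ α : ℝ, 0 < α → ∃ A : ℝ, 0 < A ∧
        ∀ (γ C : ℝ) (N : ℕ) (Z B : ℝ) (μ ν : ℕ)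
          (V : Fin N → ℝ → ℝ) (W : Fin N → Fin N → ℝ → ℝ),
          1 ≤ Z →
          1 ≤ ν → ν ≤ 2 * μ →
          (∀ j, MeasureTheory.LocallyIntegrable (V j)) →
          (∀ j k, j < k → MeasureTheory.LocallyIntegrable (W j k)) →
          (∀ j x, V j x ≤ StrongField.landauPotential μ x) →
          (∀ j k, j < k → ∀ x,
            1 / Real.sqrt 2 * StrongField.landauPotential (ν - 1) (x / Real.sqrt 2) ≤ W j k x) →
          (((ν : ℝ) ≤ C ∧ 2 < γ) ∨ ((ν : ℝ) ≤ C * N ∧ 3 < γ)) →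
          2 * Z + A * Z ^ (1 + α) < (N : ℝ) →
          a₂ γ C * Z ^ γ ≤ B →
          B < a₁ * Real.exp (Z ^ (α / 4)) →
          ¬ StrongField.HasBoundState Z (B ^ (-(1 / 2) : ℝ)) V W := by
  -- The requirement is `(14 + 3L²)Z + Z ≤ (N - 1)/2` with `L²Z ≤ 4Z^{1+α}`. The left side is at
  -- most `27 Z^{1+α}`, while `A = 60` makes the right side exceed `Z + 30 Z^{1+α} - 1/2`.
  refine ⟨1, one_pos, fun _ _ => 1, fun _ _ => one_pos, fun α hα => ⟨60, by norm_num, ?_⟩⟩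
  intro γ C N Z B μ ν V W hZ hν hνμ hV hW hVμ hWν _ hN hBl hBu
  have hZ0 : 0 < Z := by linarith
  have hB : 0 < B := lt_of_lt_of_le (by positivity) hBl
  have hν1 : (1 : ℝ) ≤ ν := by exact_mod_cast hν
  have hZα : Z ≤ Z ^ (1 + α) := by
    simpa using Real.rpow_le_rpow_of_exponent_le hZ (by linarith : (1 : ℝ) ≤ 1 + α)
  have hN0 : 0 < N := by
    have : (0 : ℝ) < N := lt_trans (by positivity) hN
    exact_mod_cast this
  have hM : 0 < B ^ (-(1 / 2) : ℝ) := by positivity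
  have hq : 1 / B ^ (-(1 / 2) : ℝ) = Real.sqrt B := by
    rw [Real.rpow_neg hB.le, one_div, inv_inv, Real.sqrt_eq_rpow]
  have hqB : 0 < Real.sqrt B := Real.sqrt_pos.2 hB
  have hVv : ∀ j t, V j t ≤ 1 / Real.sqrt (t ^ 2 + (ν : ℝ) / 2) := fun j t =>
    (hVμ j t).trans (StrongField.landauPotential_le hν hνμ t)
  have hWw : ∀ j k, j < k → ∀ t, 1 / Real.sqrt (t ^ 2 + 2 * (ν : ℝ)) ≤ W j k t :=
    fun j k hjk t => StrongField.le_of_scaled_landauPotential_le hν (hWν j k hjk t)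
  have hsν : 0 < Real.sqrt ν := Real.sqrt_pos.2 (by linarith)
  have hsν2 : Real.sqrt ν ^ 2 = ν := Real.sq_sqrt (by linarith)
  -- `R` is the larger of the two lengths. At `√B/Z` the kinetic scale `√B/R²` balances `Z/R`.
  rcases le_total (Real.sqrt ν) (Real.sqrt B / Z) with hcase | hcase
  · set R := Real.sqrt B / Z with hRdef
    have hR : 0 < R := by positivity
    have hs : 0 < Real.sqrt ((ν : ℝ) / 2) := Real.sqrt_pos.2 (by linarith)
    have hsR : Real.sqrt ((ν : ℝ) / 2) ≤ R :=
      (Real.sqrt_le_sqrt (by linarith)).trans hcase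
    have hs2 : Real.sqrt ((ν : ℝ) / 2) ^ 2 = (ν : ℝ) / 2 := Real.sq_sqrt (by linarith)
    obtain ⟨φ, φ', hφ, hφ', hric⟩ := StrongField.exists_riccati hs hsR
    rw [hs2] at hric
    set s := Real.sqrt ((ν : ℝ) / 2) with hsdef
    have hL0 : 0 ≤ Real.log (2 * R / s) :=
      Real.log_nonneg (by rw [le_div_iff₀ hs]; linarith)
    -- `log(4√B) = log 4 + (log B)/2`, and `log B ≤ Z^{α/4}` with `1 ≤ Z^{α/4}`.
    have hL : Real.log (2 * R / s) ≤ 2 * Z ^ (α / 4) := by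
      have h1 : 2 * R / s ≤ 4 * Real.sqrt B := by
        have hs1 : 1 / 2 ≤ s := Real.le_sqrt_of_sq_le (by linarith)
        have hRB : R ≤ Real.sqrt B := div_le_self hqB.le hZ
        rw [div_le_iff₀ hs]
        nlinarith
      have h2 : Real.log (4 * Real.sqrt B) = Real.log 4 + Real.log B / 2 := by
        rw [Real.log_mul (by norm_num) hqB.ne', Real.log_sqrt hB.le]
      have h3 : Real.log 4 ≤ 1.5 := by
        rw [show (4 : ℝ) = 2 ^ 2 by norm_num, Real.log_pow]
        have := Real.log_two_lt_d9
        norm_num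
        linarith
      have h4 : Real.log B ≤ Z ^ (α / 4) := by
        rw [one_mul] at hBu
        exact (Real.log_le_iff_le_exp hB).2 hBu.le
      have h5 : 1 ≤ Z ^ (α / 4) := Real.one_le_rpow hZ (by positivity)
      have h6 := Real.log_le_log (by positivity) h1
      linarith
    have hL2 : Real.log (2 * R / s) ^ 2 * Z ≤ 4 * Z ^ (1 + α) := by
      have h1 : Z ^ (α / 4) * Z ^ (α / 4) * Z ≤ Z ^ (1 + α) := by
        rw [← Real.rpow_add hZ0, ← Real.rpow_add_one hZ0.ne']
        exact Real.rpow_le_rpow_of_exponent_le hZ (by linarith)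
      calc Real.log (2 * R / s) ^ 2 * Z ≤ (2 * Z ^ (α / 4)) ^ 2 * Z := by gcongr
        _ = 4 * (Z ^ (α / 4) * Z ^ (α / 4) * Z) := by ring
        _ ≤ _ := by linarith
    -- The kinetic prefactor becomes `Z R`, so `Z` times the Riccati inequality is the bound needed,
    -- and the localization error `√B/R` is exactly `Z`.
    have hZR : Real.sqrt B = Z * R := by rw [hRdef]; field_simp
    refine StrongField.not_hasBoundState (Z' := Z * (14 + 3 * Real.log (2 * R / s) ^ 2)) hN0 hZ0.le
      hM hR (by linarith : (0 : ℝ) < ν) ?_ hV hW hVv hWw hφ hφ' ?_ ?_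
    · rw [← hsν2]; gcongr
    · intro t
      rw [hq, hZR]
      have := mul_le_mul_of_nonneg_left (hric t) hZ0.le
      calc _ = Z * (1 / Real.sqrt (t ^ 2 + (ν : ℝ) / 2)
            - (14 + 3 * Real.log (2 * R / s) ^ 2) / Real.sqrt (t ^ 2 + R ^ 2)) := by ring
        _ ≤ _ := this
        _ = _ := by ring
    · rw [hq, hZR, mul_div_cancel_right₀ _ hR.ne']
      linarith
  -- The potential is already smooth on the scale `R = √ν`: `(t² + ν/2)^{-1/2} ≤ 2(t² + ν)^{-1/2}`,
  -- so the kinetic energy of the removed particle is dropped by taking `φ = 0`.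
  · refine StrongField.not_hasBoundState (R := Real.sqrt ν) (Z' := 2 * Z) hN0 hZ0.le hM hsν
      (by linarith : (0 : ℝ) < ν) hsν2.ge hV hW hVv hWw (φ := fun _ => 0) (φ' := fun _ => 0)
      (fun t => hasDerivAt_const t 0) continuous_const ?_ ?_
    · intro t
      have h1 : 1 / Real.sqrt (t ^ 2 + (ν : ℝ) / 2) ≤ 2 / Real.sqrt (t ^ 2 + Real.sqrt ν ^ 2) := by
        rw [hsν2, div_le_div_iff₀ (Real.sqrt_pos.2 (by positivity)) (Real.sqrt_pos.2 (by positivity)),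
          one_mul]
        refine Real.sqrt_le_iff.2 ⟨by positivity, ?_⟩
        rw [mul_pow, Real.sq_sqrt (by positivity)]
        nlinarith [sq_nonneg t]
      have h2 := mul_le_mul_of_nonneg_left h1 hZ0.le
      have h3 : 2 * Z / Real.sqrt (t ^ 2 + Real.sqrt ν ^ 2)
        = Z * (2 / Real.sqrt (t ^ 2 + Real.sqrt ν ^ 2)) := by ring
      rw [h3]
      simp only [ne_eq, OfNat.ofNat_ne_zero, not_false_eq_true, zero_pow, sub_self, mul_zero]
      linarith
    · have h1 : 1 / B ^ (-(1 / 2) : ℝ) / Real.sqrt ν ≤ Z := by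
        rw [hq, div_le_iff₀ hsν]
        rwa [div_le_iff₀ hZ0, mul_comm] at hcase
      linarith
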